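/- Let $n,N\ge 1$ be integers. Let $\{\mathbf x_j\}_{j}\subset\mathbb R^n$ be a family of nodes and $\{h_j\}_j$ positive numbers. Write $B(\mathbf x,r)$ for the open ball and $m_N=\frac{(N-1+n)!}{n!\,(N-1)!}-1$, the number of multi-indices $\alpha\in\mathbb N_0^n$ with $1\le|\alpha|\le N-1$. Suppose that there is a constant $c_V>0$ such that for every $j$ there is given a set $\mathrm{st}(\mathbf x_j)$ of $m_N$ nodes (the star of $\mathbf x_j$), all lying in $B(\mathbf x_j,h_j)$, with $$\Big|\det\Big\{\Big(\frac{\mathbf x_k-\mathbf x_j}{h_j}\Big)^{\alpha}\Big\}_{\mathbf x_k\in \mathrm{st}(\mathbf x_j),\ 1\le|\alpha|\le N-1}\Big|\ge c_V ,$$ and let $\mathrm{ST}(\mathbf x_j)=\{\mathbf x_j\}\cup\mathrm{st}(\mathbf x_j)$. Let $\eta:\mathbb R^n\to\mathbb R$ be continuously differentiable, and suppose that there are constants $K>0$, $p>0$, $\rho\ge 1$, $c>0$ and $c_K,c_K',c_p<\infty$ with $$\Big\|\sum_j\big(1+h_j^{-1}|\cdot-\mathbf x_j|\big)^{-K}\Big\|_{L_\infty}\le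 c_K,\qquad \Big\|\sum_j\big(1+h_j^{-1}|\cdot-\mathbf x_j|\big)^{N-K}\Big\|_{L_\infty}\le c_K',$$ $$\big\|(1+|\cdot|)^{K}e^{p^2|\cdot|^2}\eta\big\|_{L_\infty}\le c_p,\qquad \big\|(1+|\cdot|)^{K}\nabla\eta\big\|_{L_\infty}\le c_p,$$ $$\frac{h_j}{h_m}\le \rho\ \text{ for all } j,m,\qquad \sum_j\eta\Big(\frac{\mathbf x-\mathbf x_j}{h_j}\Big)\ge c\ \text{ for all }\mathbf x\in\mathbb R^n .$$ Then there is a constant $C$, depending only on $n,N,K,p,c_K,c_K',c_p,c,c_V,\rho$, such that for every $\varepsilon>0$ there exist polynomials $\mathcal P_{j,k}$ in $n$ variables, with uniformly bounded degrees, such that for every $u\in W^N_\infty(\mathbb R^n)$ (identified with its continuous representative) and every $\mathbf x\in\mathbb R^n$ the series in $$Mu(\mathbf x)=\sum_{k}u(\mathbf x_k)\sum_{j:\ \mathrm{ST}(\mathbf x_j)\ni\mathbf x_k}\mathcal P_{j,k}\Big(\frac{\mathbf x-\mathbf x_j}{h_j}\Big)\,\eta\Big(\frac{\mathbf x-\mathbf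 x_j}{h_j}\Big)$$ converge absolutely (the inner ones for every $k$, and the outer one) and $$|Mu(\mathbf x)-u(\mathbf x)|\le C\,\sup_m h_m^N\,\|\nabla_N u\|_{L_\infty}+\varepsilon\,|u(\mathbf x)| .$$ Here $|\nabla_N u|$ denotes the Euclidean length of the vector of all weak partial derivatives $\partial_{i_1}\cdots\partial_{i_N}u$, $1\le i_1,\dots,i_N\le n$. In particular $C$ and the polynomials $\mathcal P_{j,k}$ do not depend on $u$, and $C$ does not depend on $\varepsilon$. -/

import Mathlib

open MeasureTheory
open scoped ContDiff

noncomputable section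

/-- The classical partial derivative `∂_{a 0} ⋯ ∂_{a (k-1)} φ` at `x`, for a sufficiently smooth `φ`
on `ℝⁿ`. -/
def partialDeriv {n k : ℕ} (a : Fin k → Fin n) (φ : EuclideanSpace ℝ (Fin n) → ℝ)
    (x : EuclideanSpace ℝ (Fin n)) : ℝ :=
  iteratedFDeriv ℝ k φ x (fun i => EuclideanSpace.single (a i) (1 : ℝ))

/-- `g` is the weak partial derivative `∂_{a 0} ⋯ ∂_{a (k-1)} u` on `ℝⁿ`. -/
def IsWeakDeriv {n k : ℕ} (a : Fin k → Fin n) (u g : EuclideanSpace ℝ (Fin n) → ℝ) : Prop :=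
  LocallyIntegrable u volume ∧ LocallyIntegrable g volume ∧
    ∀ φ : EuclideanSpace ℝ (Fin n) → ℝ, ContDiff ℝ ∞ φ → HasCompactSupport φ →
      ∫ x, u x * partialDeriv a φ x = (-1) ^ k * ∫ x, g x * φ x

/-- The Sobolev space `W^N_∞(ℝⁿ)`: all weak derivatives of order at most `N` exist and are
essentially bounded. -/
def MemSobolevInfty {n : ℕ} (N : ℕ) (u : EuclideanSpace ℝ (Fin n) → ℝ) : Prop :=
  MemLp u ⊤ volume ∧
    ∀ k ≤ N, ∀ a : Fin k → Fin n, ∃ g, MemLp g ⊤ volume ∧ IsWeakDeriv a u g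

open Classical in
/-- A representative of the weak derivative `∂_{a 0} ⋯ ∂_{a (k-1)} u` (which is unique almost
everywhere); zero if there is no weak derivative. -/
def weakDeriv {n k : ℕ} (a : Fin k → Fin n) (u : EuclideanSpace ℝ (Fin n) → ℝ) :
    EuclideanSpace ℝ (Fin n) → ℝ :=
  if h : ∃ g, IsWeakDeriv a u g then h.choose else 0

/-- `‖∇_N u‖_{L_∞}`, where `|∇_N u|` is the Euclidean length of the vector of all partial
derivatives `∂_{a 0} ⋯ ∂_{a (N-1)} u`. -/
def gradNorm {n : ℕ} (N : ℕ) (u : EuclideanSpace ℝ (Fin n) → ℝ) : ℝ :=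
  (eLpNorm (fun x => Real.sqrt (∑ a : Fin N → Fin n, weakDeriv a u x ^ 2)) ⊤ volume).toReal

/-- `‖∑_j (1 + h_j⁻¹ |· - x_j|)^s‖_{L_∞}`, as a value in `[0, ∞]`. -/
def gridNorm {n : ℕ} {ι : Type*} (x : ι → EuclideanSpace ℝ (Fin n)) (h : ι → ℝ) (s : ℝ) :
    ENNReal :=
  essSup (fun y => ∑' j, ENNReal.ofReal ((1 + (h j)⁻¹ * ‖y - x j‖) ^ s)) volume

/-- The multi-indices `α ∈ ℕⁿ` with `1 ≤ |α| ≤ N - 1`. There are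
`m_N = (N-1+n)! / (n! (N-1)!) - 1` of them. -/
def multiIdx (n N : ℕ) : Finset (Fin n → ℕ) :=
  (Fintype.piFinset fun _ : Fin n => Finset.range N).filter
    fun α => 1 ≤ ∑ i, α i ∧ ∑ i, α i < N

/-- The Vandermonde matrix `{((x_k - x_j) / h_j)^β}` of the node `x_j`, the nodes `x_k` of its star
being listed by `e` (by as many labels as there are columns `β`). -/
def vandermondeStar {n : ℕ} {ι : Type*} (N : ℕ) (x : ι → EuclideanSpace ℝ (Fin n)) (h : ι → ℝ)
    (j : ι) (e : multiIdx n N → ι) : Matrix (multiIdx n N) (multiIdx n N) ℝ :=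
  Matrix.of fun α β => ∏ i, ((x (e α) i - x j i) / h j) ^ β.1 i

/-- For every `j`, the star `st j` consists of `m_N` nodes in the ball `B(x_j, h_j)`, and the
Vandermonde determinant satisfies `|det V_{j,h_j}| ≥ c`. (Its absolute value does not depend on the
order in which the nodes are listed.) -/
def StarCondition {n : ℕ} {ι : Type*} (N : ℕ) (c : ℝ) (x : ι → EuclideanSpace ℝ (Fin n))
    (h : ι → ℝ) (st : ι → Finset ι) : Prop :=
  ∀ j, (∀ k ∈ st j, x k ∈ Metric.ball (x j) (h j)) ∧
    ∃ e : multiIdx n N ≃ st j, c ≤ |(vandermondeStar N x h j fun α => (e α : ι)).det|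

/-- `ST(x_j)`: the node `x_j` together with its star. -/
def fullStar {ι : Type*} (st : ι → Finset ι) (j : ι) : Set ι := insert j (st j : Set ι)

/-- The term `P_{j,k}((y - x_j)/h_j) η((y - x_j)/h_j)`. -/
def basisTerm {n : ℕ} {ι : Type*} (x : ι → EuclideanSpace ℝ (Fin n)) (h : ι → ℝ)
    (η : EuclideanSpace ℝ (Fin n) → ℝ) (P : ι → ι → MvPolynomial (Fin n) ℝ)
    (j k : ι) (y : EuclideanSpace ℝ (Fin n)) : ℝ :=
  MvPolynomial.eval (fun i => ((h j)⁻¹ • (y - x j)) i) (P j k) * η ((h j)⁻¹ • (y - x j))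

/-- The coefficient `∑_{ST(x_j) ∋ x_k} P_{j,k}((y - x_j)/h_j) η((y - x_j)/h_j)` of `u(x_k)`. -/
def nodeCoeff {n : ℕ} {ι : Type*} (x : ι → EuclideanSpace ℝ (Fin n)) (h : ι → ℝ)
    (st : ι → Finset ι) (η : EuclideanSpace ℝ (Fin n) → ℝ) (P : ι → ι → MvPolynomial (Fin n) ℝ)
    (k : ι) (y : EuclideanSpace ℝ (Fin n)) : ℝ :=
  ∑' j : {j : ι // k ∈ fullStar st j}, basisTerm x h η P j k y

/-- The quasi-interpolant `M u(y) = ∑_k u(x_k) ∑_{ST(x_j) ∋ x_k} P_{j,k}(⋯) η(⋯)`. -/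
def quasiInterpolant {n : ℕ} {ι : Type*} (x : ι → EuclideanSpace ℝ (Fin n)) (h : ι → ℝ)
    (st : ι → Finset ι) (η : EuclideanSpace ℝ (Fin n) → ℝ) (P : ι → ι → MvPolynomial (Fin n) ℝ)
    (u : EuclideanSpace ℝ (Fin n) → ℝ) (y : EuclideanSpace ℝ (Fin n)) : ℝ :=
  ∑' k, u (x k) * nodeCoeff x h st η P k y

end

/-!
The quasi-interpolant combines two constructions.

*An approximate partition of unity.* Put `Θ(y) = ∑_j η((y - x_j) / h_j)`, a function bounded below
by `cs`. In the coordinates of the node `x_j`, the functions `t ↦ 1 / Θ(x_j + h_j t)` are bounded by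
`1 / cs` and equicontinuous, uniformly in `j`: the decay of `∇η`, the bound on the sums over the
nodes and `h_j / h_m ≤ ρ` give a Lipschitz bound. Polynomials are dense in the space of continuous
functions with weight `exp (-p² |t|²)`, and the family has a finite net in this weighted norm, so
there are polynomials `Q_j` of bounded degree with `|Q_j - 1 / Θ| ≤ δ exp (p² |t|²)`
(`exists_polynomial_family_near`). Since `η` decays like `exp (-p² |t|²) (1 + |t|)^(-K)`, the sum
`∑_j Q_j η` is within `ε` of `1`, while `|Q_j η| ≤ (1 / cs + 1) cp (1 + |t|)^(-K)` whatever `ε` is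
(`exists_approximate_partition_of_unity`). This is why `C` does not depend on `ε`.

The density (`GaussApprox.of_bounded`) comes from the Stone–Weierstrass theorem: the bounded
continuous functions that are approximable with respect to all Gaussian weights form an algebra,
which contains the sines of the coordinates because their Taylor series converge in these norms, and
which therefore separates points. An approximation on a large ball is made bounded on the whole space
by composing it with a polynomial close to a truncation.

*Local interpolation.* The Vandermonde condition bounds the inverse of the Vandermonde matrix, hence
the Lagrange basis `Λ_{j,k}` of the polynomials of degree `< N` on the star of `x_j`. The functional
`u ↦ ∑_k Λ_{j,k}(t) u(x_k) - u(x_j + h_j t)` annihilates these polynomials, so it is at most a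
constant times `h_j^N (1 + |t|)^N ‖∇_N u‖` (`exists_star_interpolation`). For smooth functions this
is Taylor's formula; for `u` in the Sobolev space it follows by mollification, as only finitely many
point values of `u` are involved (`abs_sum_le_gradNorm_of_annihilates`).

With `P_{j,k} = Q_j Λ_{j,k}` and summation star by star, the error of the quasi-interpolant is
`∑_j Q_j η (∑_k Λ_{j,k} u(x_k) - u(y)) + (∑_j Q_j η - 1) u(y)`, and the two bounds give the estimate.
-/

/-! ### Polynomial approximation with Gaussian weights -/

/-- `f` is approximable by polynomials uniformly with respect to every weight `exp (-c |t|²)`. -/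
def GaussApprox {n : ℕ} (f : EuclideanSpace ℝ (Fin n) → ℝ) : Prop :=
  ∀ c : ℝ, 0 < c → ∀ δ : ℝ, 0 < δ → ∃ P : MvPolynomial (Fin n) ℝ,
    ∀ t : EuclideanSpace ℝ (Fin n),
      |MvPolynomial.eval (fun i => t i) P - f t| ≤ δ * Real.exp (c * ‖t‖ ^ 2)

theorem GaussApprox.const {n : ℕ} (r : ℝ) :
    GaussApprox (fun _ : EuclideanSpace ℝ (Fin n) => r) := fun c _ δ hδ =>
  ⟨MvPolynomial.C r, fun t => by
    simpa using (mul_pos hδ (Real.exp_pos _)).le⟩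

theorem GaussApprox.add {n : ℕ} {f g : EuclideanSpace ℝ (Fin n) → ℝ} (hf : GaussApprox f)
    (hg : GaussApprox g) : GaussApprox fun t => f t + g t := fun c hc δ hδ => by
  obtain ⟨P, hP⟩ := hf c hc (δ / 2) (half_pos hδ)
  obtain ⟨Q, hQ⟩ := hg c hc (δ / 2) (half_pos hδ)
  refine ⟨P + Q, fun t => ?_⟩
  rw [map_add, add_sub_add_comm]
  refine (abs_add_le _ _).trans ((add_le_add (hP t) (hQ t)).trans_eq ?_)
  ring

/-- Half of the Gaussian weight pays for the growth of the polynomial that approximates the first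
factor, the other half for the approximation of the second. -/
theorem GaussApprox.mul {n : ℕ} {f g : EuclideanSpace ℝ (Fin n) → ℝ} (hf : GaussApprox f)
    (hg : GaussApprox g) {A B : ℝ} (hA : ∀ t, |f t| ≤ A) (hB : ∀ t, |g t| ≤ B) :
    GaussApprox fun t => f t * g t := fun c hc δ hδ => by
  have hA0 : 0 ≤ A := (abs_nonneg _).trans (hA 0)
  have hB0 : 0 ≤ B := (abs_nonneg _).trans (hB 0)
  obtain ⟨P, hP⟩ := hf (c / 2) (half_pos hc) (min 1 (δ / (2 * (B + 1))))
    (lt_min one_pos (by positivity))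
  obtain ⟨Q, hQ⟩ := hg (c / 2) (half_pos hc) (δ / (2 * (A + 1))) (by positivity)
  refine ⟨P * Q, fun t => ?_⟩
  set E := Real.exp (c / 2 * ‖t‖ ^ 2) with hE
  have hE1 : 1 ≤ E := Real.one_le_exp (by positivity)
  have hEE : Real.exp (c * ‖t‖ ^ 2) = E * E := by rw [hE, ← Real.exp_add]; congr 1; ring
  set p := MvPolynomial.eval (fun i => t i) P
  set q := MvPolynomial.eval (fun i => t i) Q
  have hp : |p| ≤ (A + 1) * E := by
    have h1 : |p - f t| ≤ 1 * E :=
      (hP t).trans (mul_le_mul_of_nonneg_right (min_le_left _ _) (by positivity))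
    have h2 : A ≤ A * E := le_mul_of_one_le_right hA0 hE1
    calc |p| = |(p - f t) + f t| := by rw [sub_add_cancel]
      _ ≤ |p - f t| + |f t| := abs_add_le _ _
      _ ≤ (A + 1) * E := by linarith [hA t]
  have h3 : |p - f t| ≤ δ / (2 * (B + 1)) * E :=
    (hP t).trans (mul_le_mul_of_nonneg_right (min_le_right _ _) (by positivity))
  rw [map_mul, hEE]
  calc |p * q - f t * g t| = |p * (q - g t) + (p - f t) * g t| := by ring_nf
    _ ≤ |p| * |q - g t| + |p - f t| * |g t| := by
        rw [← abs_mul, ← abs_mul]; exact abs_add_le _ _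
    _ ≤ ((A + 1) * E) * (δ / (2 * (A + 1)) * E) + (δ / (2 * (B + 1)) * E) * (B + 1) := by
        gcongr
        · exact hQ t
        · exact (hB t).trans (by linarith)
    _ = δ / 2 * (E * E) + δ / 2 * E := by field_simp
    _ ≤ δ / 2 * (E * E) + δ / 2 * (E * E) := by
        gcongr
        exact le_mul_of_one_le_left (by positivity) hE1
    _ = δ * (E * E) := by ring

/-- The sine of a coordinate has order of growth one, so its Taylor polynomials converge with
respect to Gaussian weights. -/
theorem GaussApprox.sin {n : ℕ} (a : ℝ) (i : Fin n) :
    GaussApprox fun t : EuclideanSpace ℝ (Fin n) => Real.sin (a * t i) := fun c hc δ hδ => by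
  have hlim : Filter.Tendsto (fun M : ℕ => Real.exp (a ^ 2 / c) * (1 / 4 : ℝ) ^ M / (1 - 1 / 4))
      Filter.atTop (nhds 0) := by
    have := ((tendsto_pow_atTop_nhds_zero_of_lt_one (by norm_num : (0 : ℝ) ≤ 1 / 4)
      (by norm_num)).const_mul (Real.exp (a ^ 2 / c))).div_const (1 - 1 / 4 : ℝ)
    simpa using this
  obtain ⟨M, hM⟩ := (hlim.eventually_lt_const hδ).exists
  refine ⟨∑ m ∈ Finset.range M, MvPolynomial.C ((-1) ^ m / ((2 * m + 1).factorial : ℝ)) *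
    (MvPolynomial.C a * MvPolynomial.X i) ^ (2 * m + 1), fun t => ?_⟩
  set x := a * t i with hx
  have hterm : ∀ m : ℕ, ‖(-1) ^ m * x ^ (2 * m + 1) / ((2 * m + 1).factorial : ℝ)‖
      ≤ Real.exp (2 * |x|) * (1 / 4 : ℝ) ^ m := fun m => by
    have h1 := Real.pow_div_factorial_le_exp (2 * |x|) (by positivity) (2 * m + 1)
    rw [mul_pow] at h1
    have h2 : ‖(-1) ^ m * x ^ (2 * m + 1) / ((2 * m + 1).factorial : ℝ)‖
        = |x| ^ (2 * m + 1) / ((2 * m + 1).factorial : ℝ) := by simp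
    have h3 : (2 : ℝ) ^ (2 * m + 1) * (1 / 4 : ℝ) ^ m = 2 := by
      rw [pow_succ, pow_mul, mul_right_comm, ← mul_pow]; norm_num
    rw [h2]
    calc |x| ^ (2 * m + 1) / ((2 * m + 1).factorial : ℝ)
        ≤ 2 * (|x| ^ (2 * m + 1) / ((2 * m + 1).factorial : ℝ)) := by
          exact le_mul_of_one_le_left (by positivity) one_le_two
      _ = (2 ^ (2 * m + 1) * |x| ^ (2 * m + 1) / ((2 * m + 1).factorial : ℝ)) * (1 / 4 : ℝ) ^ m := by
          conv_lhs => rw [← h3]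
          ring
      _ ≤ _ := mul_le_mul_of_nonneg_right h1 (by positivity)
  have hb := norm_sub_le_of_geometric_bound_of_hasSum (by norm_num) hterm (Real.hasSum_sin x) M
  have hev : MvPolynomial.eval (fun i => t i) (∑ m ∈ Finset.range M,
      MvPolynomial.C ((-1) ^ m / ((2 * m + 1).factorial : ℝ)) *
        (MvPolynomial.C a * MvPolynomial.X i) ^ (2 * m + 1))
      = ∑ m ∈ Finset.range M, (-1) ^ m * x ^ (2 * m + 1) / ((2 * m + 1).factorial : ℝ) := by
    rw [map_sum]
    refine Finset.sum_congr rfl fun m _ => ?_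
    simp only [map_mul, map_pow, MvPolynomial.eval_C, MvPolynomial.eval_X, ← hx]
    ring
  rw [hev]
  refine hb.trans ?_
  have hexp : Real.exp (2 * |x|) ≤ Real.exp (a ^ 2 / c) * Real.exp (c * ‖t‖ ^ 2) := by
    rw [← Real.exp_add, Real.exp_le_exp, hx, abs_mul]
    have h1 : |t i| ≤ ‖t‖ := by simpa using PiLp.norm_apply_le t i
    have h2 : a ^ 2 / c + c * ‖t‖ ^ 2 - 2 * (|a| * ‖t‖) = (|a| - c * ‖t‖) ^ 2 / c := by
      rw [← sq_abs a]; field_simp; ring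
    have h3 : 0 ≤ (|a| - c * ‖t‖) ^ 2 / c := by positivity
    have h4 : |a| * |t i| ≤ |a| * ‖t‖ := mul_le_mul_of_nonneg_left h1 (abs_nonneg a)
    linarith
  calc Real.exp (2 * |x|) * (1 / 4 : ℝ) ^ M / (1 - 1 / 4)
      ≤ (Real.exp (a ^ 2 / c) * Real.exp (c * ‖t‖ ^ 2)) * (1 / 4 : ℝ) ^ M / (1 - 1 / 4) := by
        gcongr
    _ = (Real.exp (a ^ 2 / c) * (1 / 4 : ℝ) ^ M / (1 - 1 / 4)) * Real.exp (c * ‖t‖ ^ 2) := by ring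
    _ ≤ δ * Real.exp (c * ‖t‖ ^ 2) := by gcongr

/-- The algebra of bounded continuous functions that polynomials approximate with respect to all
Gaussian weights. -/
def gaussAlgebra (n : ℕ) : Subalgebra ℝ C(EuclideanSpace ℝ (Fin n), ℝ) where
  carrier := {f | (∃ A, ∀ t, |f t| ≤ A) ∧ GaussApprox f}
  mul_mem' := by
    rintro f g ⟨⟨A, hA⟩, hf⟩ ⟨⟨B, hB⟩, hg⟩
    refine ⟨⟨A * B, fun t => ?_⟩, hf.mul hg hA hB⟩
    rw [ContinuousMap.mul_apply, abs_mul]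
    exact mul_le_mul (hA t) (hB t) (abs_nonneg _) ((abs_nonneg _).trans (hA t))
  add_mem' := by
    rintro f g ⟨⟨A, hA⟩, hf⟩ ⟨⟨B, hB⟩, hg⟩
    exact ⟨⟨A + B, fun t => (abs_add_le _ _).trans (add_le_add (hA t) (hB t))⟩, hf.add hg⟩
  algebraMap_mem' r := ⟨⟨|r|, fun _ => le_rfl⟩, GaussApprox.const r⟩

theorem gaussAlgebra_separatesPoints (n : ℕ) : (gaussAlgebra n).SeparatesPoints := by
  intro s t hst
  obtain ⟨i, hi⟩ : ∃ i, s i ≠ t i := by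
    by_contra! h
    exact hst (by ext i; exact h i)
  set a : ℝ := (1 + |s i| + |t i|)⁻¹ with ha
  have hpos : 0 < 1 + |s i| + |t i| := by positivity
  have hsmall : ∀ r : ℝ, |r| ≤ 1 + |s i| + |t i| →
      a * r ∈ Set.Icc (-(Real.pi / 2)) (Real.pi / 2) := by
    intro r hr
    have h1 : |a * r| ≤ 1 := by
      rw [abs_mul, ha, abs_of_pos (inv_pos.mpr hpos), inv_mul_le_iff₀ hpos, mul_one]
      exact hr
    have h2 := abs_le.mp h1
    have h3 := Real.pi_gt_three
    exact ⟨by linarith [h2.1], by linarith [h2.2]⟩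
  refine ⟨_, ⟨⟨fun r => Real.sin (a * r i), by fun_prop⟩,
    ⟨⟨1, fun r => Real.abs_sin_le_one _⟩, GaussApprox.sin a i⟩, rfl⟩, fun h => hi ?_⟩
  have h1 := Real.injOn_sin (hsmall (s i) (by linarith [abs_nonneg (t i)]))
    (hsmall (t i) (by linarith [abs_nonneg (s i)])) h
  exact mul_left_cancel₀ (inv_pos.mpr hpos).ne' h1

theorem exists_forall_le_mul_exp_sq {E : Type*} [SeminormedAddGroup E] {c δ : ℝ} (hc : 0 < c)
    (hδ : 0 < δ) (M : ℝ) : ∃ R : ℝ, ∀ t : E, R < ‖t‖ → M ≤ δ * Real.exp (c * ‖t‖ ^ 2) := by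
  refine ⟨Real.sqrt (M / δ / c), fun t ht => ?_⟩
  have h1 : M / δ / c ≤ ‖t‖ ^ 2 := (Real.sqrt_le_left (norm_nonneg t)).mp ht.le
  rw [div_le_iff₀ hc] at h1
  rw [← div_le_iff₀' hδ]
  linarith [Real.add_one_le_exp (c * ‖t‖ ^ 2)]

/-- Bounded continuous functions are approximable: on a large ball by the Stone–Weierstrass
theorem; composing the approximation with a polynomial that is close to a truncation keeps it
bounded by about `sup |f|` outside the ball, where the weight is small. -/
theorem GaussApprox.of_bounded {n : ℕ} {f : EuclideanSpace ℝ (Fin n) → ℝ} (hf : Continuous f)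
    {A : ℝ} (hA : ∀ t, |f t| ≤ A) : GaussApprox f := fun c hc δ hδ => by
  have hA0 : 0 ≤ A := (abs_nonneg _).trans (hA 0)
  obtain ⟨R, hR⟩ := exists_forall_le_mul_exp_sq (E := EuclideanSpace ℝ (Fin n)) hc (half_pos hδ)
    (2 * A)
  obtain ⟨g, hg, hgf⟩ :=
    ContinuousMap.exists_mem_subalgebra_near_continuous_of_isCompact_of_separatesPoints
      (gaussAlgebra_separatesPoints n) ⟨f, hf⟩
      (isCompact_closedBall (0 : EuclideanSpace ℝ (Fin n)) R) (by positivity : 0 < δ / 8)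
  obtain ⟨B, hB⟩ := hg.1
  obtain ⟨r, hr⟩ := exists_polynomial_near_of_continuousOn (-B) B
    (fun s => max (-A) (min A s)) (by fun_prop) (δ / 8) (by positivity)
  have hrg : Polynomial.aeval g r ∈ gaussAlgebra n :=
    (Algebra.adjoin_le (by simpa using hg) (Polynomial.aeval_mem_adjoin_singleton ℝ g))
  have hval : ∀ t, (Polynomial.aeval g r) t = Polynomial.eval (g t) r := fun t => by
    induction r using Polynomial.induction_on' <;> simp_all
  obtain ⟨P, hP⟩ := hrg.2 c hc (δ / 8) (by positivity)
  refine ⟨P, fun t => ?_⟩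
  have hE1 : 1 ≤ Real.exp (c * ‖t‖ ^ 2) := Real.one_le_exp (by positivity)
  have h1 := hP t
  have h2 : |(Polynomial.aeval g r) t - max (-A) (min A (g t))| < δ / 8 := by
    rw [hval]
    exact hr (g t) (abs_le.mp (hB t))
  have h3 : |max (-A) (min A (g t)) - f t| ≤ δ / 2 * Real.exp (c * ‖t‖ ^ 2) := by
    by_cases ht : ‖t‖ ≤ R
    · have h4 := hgf t (by simpa using ht)
      replace h4 : -(δ / 8) < g t - f t ∧ g t - f t < δ / 8 := abs_lt.mp h4
      have h5 := abs_le.mp (hA t)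
      have h6 : |max (-A) (min A (g t)) - f t| ≤ δ / 8 := by
        rw [abs_le]
        constructor
        · have : f t - δ / 8 ≤ max (-A) (min A (g t)) :=
            le_max_of_le_right (le_min (by linarith) (by linarith))
          linarith
        · have : max (-A) (min A (g t)) ≤ f t + δ / 8 :=
            max_le (by linarith) ((min_le_right _ _).trans (by linarith))
          linarith
      nlinarith
    · have h5 := abs_le.mp (hA t)
      have h6 : max (-A) (min A (g t)) ≤ A := max_le (by linarith) (min_le_left _ _)
      have h7 : -A ≤ max (-A) (min A (g t)) := le_max_left _ _
      have h9 : |max (-A) (min A (g t)) - f t| ≤ 2 * A :=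
        abs_le.mpr ⟨by linarith [h5.2], by linarith [h5.1]⟩
      exact h9.trans (hR t (not_le.mp ht))
  calc |MvPolynomial.eval (fun i => t i) P - f t|
      = |(MvPolynomial.eval (fun i => t i) P - (Polynomial.aeval g r) t)
        + ((Polynomial.aeval g r) t - max (-A) (min A (g t)))
        + (max (-A) (min A (g t)) - f t)| := by ring_nf
    _ ≤ _ := abs_add_three _ _ _
    _ ≤ δ / 8 * Real.exp (c * ‖t‖ ^ 2) + δ / 8 * Real.exp (c * ‖t‖ ^ 2)
        + δ / 2 * Real.exp (c * ‖t‖ ^ 2) := by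
        gcongr
        exact h2.le.trans (le_mul_of_one_le_right (by positivity) hE1)
    _ ≤ δ * Real.exp (c * ‖t‖ ^ 2) := by nlinarith

/-- A bounded and uniformly equicontinuous family has a finite net in the Gaussian-weighted
supremum norm, so that polynomials of bounded degree approximate it. The net consists of one
member for each table of rounded values at finitely many points of a large ball. -/
theorem exists_polynomial_family_near {n : ℕ} {J : Type*} (F : J → EuclideanSpace ℝ (Fin n) → ℝ)
    {A : ℝ} (hA : ∀ j t, |F j t| ≤ A)
    (hF : ∀ τ : ℝ, 0 < τ → ∃ r : ℝ, 0 < r ∧ ∀ j s t, ‖s - t‖ < r → |F j s - F j t| ≤ τ)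
    {c δ : ℝ} (hc : 0 < c) (hδ : 0 < δ) :
    ∃ (L : ℕ) (P : J → MvPolynomial (Fin n) ℝ), ∀ j, (P j).totalDegree ≤ L ∧
      ∀ t : EuclideanSpace ℝ (Fin n),
        |MvPolynomial.eval (fun i => t i) (P j) - F j t| ≤ δ * Real.exp (c * ‖t‖ ^ 2) := by
  rcases isEmpty_or_nonempty J with hJ | hJ
  · exact ⟨0, fun _ => 0, fun j => hJ.elim j⟩
  obtain ⟨j₀⟩ := id hJ
  have hA0 : 0 ≤ A := (abs_nonneg _).trans (hA j₀ 0)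
  have hcont : ∀ j, Continuous (F j) := fun j => by
    refine Metric.continuous_iff.mpr fun t τ hτ => ?_
    obtain ⟨r, hr, h⟩ := hF (τ / 2) (half_pos hτ)
    refine ⟨r, hr, fun s hs => ?_⟩
    rw [dist_eq_norm] at hs
    rw [Real.dist_eq]
    exact (h j s t hs).trans_lt (half_lt_self hτ)
  obtain ⟨R, hR⟩ := exists_forall_le_mul_exp_sq (E := EuclideanSpace ℝ (Fin n)) hc (half_pos hδ)
    (2 * A)
  obtain ⟨r, hr, hFr⟩ := hF (δ / 8) (by positivity)
  obtain ⟨Z, -, hZfin, hZ⟩ :=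
    (isCompact_closedBall (0 : EuclideanSpace ℝ (Fin n)) R).finite_cover_balls hr
  have : Finite Z := hZfin
  have : Fintype Z := Fintype.ofFinite Z
  set B : ℤ := ⌈A / (δ / 8)⌉ + 1 with hB
  have hfloor : ∀ j (z : Z), ⌊F j z / (δ / 8)⌋ ∈ Set.Icc (-B) B := fun j z => by
    have h1 := abs_le.mp (hA j z)
    have h2 := Int.le_ceil (A / (δ / 8))
    have h3 : F j z / (δ / 8) ≤ A / (δ / 8) := by gcongr; exact h1.2
    have h4 : -(A / (δ / 8)) ≤ F j z / (δ / 8) := by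
      rw [← neg_div]; gcongr; exact h1.1
    constructor
    · rw [Int.le_floor, hB]; push_cast; linarith
    · rw [← Int.cast_le (R := ℝ), hB]; push_cast
      linarith [Int.floor_le (F j z / (δ / 8))]
  let pat : J → (Z → Set.Icc (-B) B) := fun j z => ⟨⌊F j z / (δ / 8)⌋, hfloor j z⟩
  choose Q hQ using fun j => GaussApprox.of_bounded (hcont j) (hA j) c hc (δ / 2) (half_pos hδ)
  let rep : J → J := fun j => Function.invFun pat (pat j)
  have hrep : ∀ j, pat (rep j) = pat j := fun j => Function.invFun_eq ⟨j, rfl⟩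
  obtain ⟨L, hL⟩ : BddAbove (Set.range fun q : Z → Set.Icc (-B) B =>
      (Q (Function.invFun pat q)).totalDegree) := (Set.finite_range _).bddAbove
  refine ⟨L, fun j => Q (rep j), fun j => ⟨hL ⟨pat j, rfl⟩, fun t => ?_⟩⟩
  have hE1 : 1 ≤ Real.exp (c * ‖t‖ ^ 2) := Real.one_le_exp (by positivity)
  have key : |F (rep j) t - F j t| ≤ δ / 2 * Real.exp (c * ‖t‖ ^ 2) := by
    by_cases ht : ‖t‖ ≤ R
    · obtain ⟨z, hzZ, hz⟩ := Set.mem_iUnion₂.mp (hZ (by simpa using ht : t ∈ _))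
      rw [Metric.mem_ball, dist_eq_norm] at hz
      have h1 := abs_le.mp (hFr (rep j) t z hz)
      have h2 := abs_le.mp (hFr j t z hz)
      have h3 : ⌊F (rep j) z / (δ / 8)⌋ = ⌊F j z / (δ / 8)⌋ :=
        congrArg Subtype.val (congrFun (hrep j) ⟨z, hzZ⟩)
      have h4 := abs_lt.mp (Int.abs_sub_lt_one_of_floor_eq_floor h3)
      rw [← sub_div] at h4
      have h5 : F (rep j) z - F j z < δ / 8 := by
        have := (div_lt_iff₀ (by positivity)).mp h4.2; linarith
      have h6 : -(δ / 8) < F (rep j) z - F j z := by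
        have := (lt_div_iff₀ (by positivity)).mp h4.1; linarith
      have h7 : |F (rep j) t - F j t| ≤ δ / 2 := by
        rw [abs_le]; constructor <;> linarith [h1.1, h1.2, h2.1, h2.2]
      exact h7.trans (le_mul_of_one_le_right (by positivity) hE1)
    · have h9 : |F (rep j) t - F j t| ≤ 2 * A :=
        (abs_sub _ _).trans (by linarith [hA (rep j) t, hA j t])
      exact h9.trans (hR t (not_le.mp ht))
  calc |MvPolynomial.eval (fun i => t i) (Q (rep j)) - F j t|
      = |(MvPolynomial.eval (fun i => t i) (Q (rep j)) - F (rep j) t)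
        + (F (rep j) t - F j t)| := by ring_nf
    _ ≤ _ := abs_add_le _ _
    _ ≤ δ / 2 * Real.exp (c * ‖t‖ ^ 2) + δ / 2 * Real.exp (c * ‖t‖ ^ 2) := by
        gcongr
        exact hQ (rep j) t
    _ = _ := by ring

/-! ### Taylor expansion of smooth functions -/

/-- The `m`-th derivative on the diagonal `(v, …, v)` in terms of partial derivatives. -/
theorem iteratedFDeriv_diag_eq_sum {n : ℕ} (m : ℕ) (ψ : EuclideanSpace ℝ (Fin n) → ℝ)
    (x v : EuclideanSpace ℝ (Fin n)) :
    iteratedFDeriv ℝ m ψ x (fun _ => v)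
      = ∑ a : Fin m → Fin n, (∏ i, v (a i)) * partialDeriv a ψ x := by
  have hv : v = ∑ l, v l • EuclideanSpace.single l (1 : ℝ) := by
    have := (EuclideanSpace.basisFun (Fin n) ℝ).sum_repr v
    simpa using this.symm
  conv_lhs => rw [hv]
  rw [ContinuousMultilinearMap.map_sum]
  refine Finset.sum_congr rfl fun a _ => ?_
  rw [ContinuousMultilinearMap.map_smul_univ]
  rfl

theorem prod_comp_eq_prod_pow_card {n m : ℕ} (a : Fin m → Fin n) (v : Fin n → ℝ) :
    ∏ i, v (a i) = ∏ l, v l ^ (Finset.univ.filter fun i => a i = l).card := by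
  rw [← Finset.prod_fiberwise Finset.univ a fun i => v (a i)]
  refine Finset.prod_congr rfl fun l _ => ?_
  rw [Finset.prod_congr rfl (g := fun _ => v l), Finset.prod_const]
  intro i hi
  rw [(Finset.mem_filter.mp hi).2]

/-- If `∑ w_k δ_{z_k}` annihilates the polynomials of degree `< N`, then it is bounded on a smooth
function by the size of the derivatives of order `N`. -/
theorem abs_sum_le_of_annihilates_of_contDiff {n N : ℕ} (hN : 1 ≤ N)
    {ψ : EuclideanSpace ℝ (Fin n) → ℝ} (hψ : ContDiff ℝ ∞ ψ) {G : ℝ}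
    (hG : ∀ (a : Fin N → Fin n) x, |partialDeriv a ψ x| ≤ G)
    {κ : Type*} (s : Finset κ) (w : κ → ℝ) (z : κ → EuclideanSpace ℝ (Fin n))
    (x : EuclideanSpace ℝ (Fin n))
    (hann : ∀ α : Fin n → ℕ, ∑ i, α i < N → ∑ k ∈ s, w k * ∏ i, (z k - x) i ^ α i = 0) :
    |∑ k ∈ s, w k * ψ (z k)| ≤ (n ^ N : ℝ) * G * ∑ k ∈ s, |w k| * ‖z k - x‖ ^ N := by
  obtain ⟨N, rfl⟩ := Nat.exists_eq_succ_of_ne_zero (by omega : N ≠ 0)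
  have hdiag : ∀ (y v : EuclideanSpace ℝ (Fin n)),
      |iteratedFDeriv ℝ (N + 1) ψ y (fun _ => v)| ≤ (n ^ (N + 1) : ℝ) * G * ‖v‖ ^ (N + 1) := by
    intro y v
    rw [iteratedFDeriv_diag_eq_sum]
    refine (Finset.abs_sum_le_sum_abs _ _).trans ?_
    calc ∑ a : Fin (N + 1) → Fin n, |(∏ i, v (a i)) * partialDeriv a ψ y|
        ≤ ∑ a : Fin (N + 1) → Fin n, ‖v‖ ^ (N + 1) * G := by
          refine Finset.sum_le_sum fun a _ => ?_
          rw [abs_mul, Finset.abs_prod]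
          refine mul_le_mul ?_ (hG a y) (abs_nonneg _) (by positivity)
          calc ∏ i, |v (a i)| ≤ ∏ _i : Fin (N + 1), ‖v‖ :=
                Finset.prod_le_prod (fun _ _ => abs_nonneg _) fun i _ => by
                  simpa using PiLp.norm_apply_le v (a i)
            _ = ‖v‖ ^ (N + 1) := by simp
      _ = _ := by simp; ring
  set R : EuclideanSpace ℝ (Fin n) → ℝ := fun v =>
    ((N.factorial : ℝ))⁻¹ • ∫ t in (0 : ℝ)..1,
      (1 - t) ^ N • iteratedFDeriv ℝ (N + 1) ψ (x + t • v) (fun _ => v) with hR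
  have hRle : ∀ v, |R v| ≤ (n ^ (N + 1) : ℝ) * G * ‖v‖ ^ (N + 1) := by
    intro v
    simp only [hR]
    rw [smul_eq_mul, abs_mul]
    have h1 : |((N.factorial : ℝ))⁻¹| ≤ 1 := by
      rw [abs_of_nonneg (by positivity)]
      exact inv_le_one_of_one_le₀ (by exact_mod_cast N.factorial_pos)
    have h2 : |∫ t in (0 : ℝ)..1,
        (1 - t) ^ N • iteratedFDeriv ℝ (N + 1) ψ (x + t • v) (fun _ => v)|
        ≤ (n ^ (N + 1) : ℝ) * G * ‖v‖ ^ (N + 1) := by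
      have := intervalIntegral.norm_integral_le_of_norm_le_const (a := (0 : ℝ)) (b := 1)
        (f := fun t => (1 - t) ^ N • iteratedFDeriv ℝ (N + 1) ψ (x + t • v) (fun _ => v))
        (C := (n ^ (N + 1) : ℝ) * G * ‖v‖ ^ (N + 1)) ?_
      · simpa using this
      · intro t ht
        rw [Set.uIoc_of_le zero_le_one] at ht
        rw [norm_smul, Real.norm_eq_abs, Real.norm_eq_abs]
        have h3 : |(1 - t) ^ N| ≤ 1 := by
          rw [abs_pow]
          exact pow_le_one₀ (abs_nonneg _) (abs_le.mpr ⟨by linarith [ht.2], by linarith [ht.1]⟩)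
        calc _ ≤ 1 * _ := mul_le_mul h3 (hdiag _ _) (abs_nonneg _) zero_le_one
          _ = _ := one_mul _
    calc _ ≤ 1 * _ := mul_le_mul h1 h2 (abs_nonneg _) zero_le_one
      _ = _ := one_mul _
  have htaylor : ∀ v, ψ (x + v) = (∑ m ∈ Finset.range (N + 1), ((m.factorial : ℝ))⁻¹ *
      ∑ a : Fin m → Fin n, (∏ i, v (a i)) * partialDeriv a ψ x) + R v := by
    intro v
    have := map_add_eq_sum_add_integral_iteratedFDeriv (f := ψ) (x := x) (y := v) (n := N)
      fun t _ => (hψ.of_le (by exact_mod_cast le_top)).contDiffAt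
    rw [this]
    congr 1
    simp only [iteratedFDeriv_diag_eq_sum, smul_eq_mul]
  have hsum : ∑ k ∈ s, w k * ψ (z k) = ∑ k ∈ s, w k * R (z k - x) := by
    have h1 : ∀ k ∈ s, w k * ψ (z k) = (∑ m ∈ Finset.range (N + 1), ∑ a : Fin m → Fin n,
        ((m.factorial : ℝ))⁻¹ * partialDeriv a ψ x * (w k * ∏ i, (z k - x) (a i)))
        + w k * R (z k - x) := by
      intro k _
      have := htaylor (z k - x)
      rw [add_sub_cancel] at this
      rw [this, mul_add, Finset.mul_sum]
      congr 1
      refine Finset.sum_congr rfl fun m _ => ?_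
      rw [Finset.mul_sum, Finset.mul_sum]
      exact Finset.sum_congr rfl fun a _ => by ring
    rw [Finset.sum_congr rfl h1, Finset.sum_add_distrib, Finset.sum_comm]
    rw [add_eq_right]
    refine Finset.sum_eq_zero fun m hm => ?_
    rw [Finset.sum_comm]
    refine Finset.sum_eq_zero fun a _ => ?_
    rw [← Finset.mul_sum]
    have h2 := hann (fun l => (Finset.univ.filter fun i => a i = l).card) (by
      rw [← Finset.card_eq_sum_card_fiberwise (t := Finset.univ) (by simp)]
      simpa using hm)
    simp_rw [prod_comp_eq_prod_pow_card a]
    rw [h2, mul_zero]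
  rw [hsum]
  refine (Finset.abs_sum_le_sum_abs _ _).trans ?_
  rw [Finset.mul_sum]
  refine Finset.sum_le_sum fun k _ => ?_
  rw [abs_mul]
  calc |w k| * |R (z k - x)| ≤ |w k| * _ := mul_le_mul_of_nonneg_left (hRle _) (abs_nonneg _)
    _ = _ := by rw [Nat.succ_eq_add_one]; ring

/-! ### Mollification of Sobolev functions -/

open scoped Convolution

theorem HasCompactSupport.partialDeriv {n k : ℕ} (a : Fin k → Fin n)
    {φ : EuclideanSpace ℝ (Fin n) → ℝ} (h : HasCompactSupport φ) :
    HasCompactSupport (partialDeriv a φ) :=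
  (h.iteratedFDeriv (𝕜 := ℝ) k).comp_left
    (g := fun T : ContinuousMultilinearMap ℝ (fun _ : Fin k => EuclideanSpace ℝ (Fin n)) ℝ =>
      T fun i => EuclideanSpace.single (a i) (1 : ℝ)) (by simp)

theorem ContDiff.partialDeriv {n k : ℕ} (a : Fin k → Fin n)
    {φ : EuclideanSpace ℝ (Fin n) → ℝ} (h : ContDiff ℝ ∞ φ) :
    ContDiff ℝ ∞ (partialDeriv a φ) := by
  have h1 : ContDiff ℝ ∞ (iteratedFDeriv ℝ k φ) :=
    h.iteratedFDeriv_right (m := ∞) (by exact_mod_cast le_top)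
  exact (ContinuousMultilinearMap.apply ℝ (fun _ : Fin k => EuclideanSpace ℝ (Fin n)) ℝ
    (fun i => EuclideanSpace.single (a i) (1 : ℝ))).contDiff.comp h1

theorem partialDeriv_succ {n k : ℕ} (a : Fin (k + 1) → Fin n)
    {φ : EuclideanSpace ℝ (Fin n) → ℝ} (h : ContDiff ℝ ∞ φ) (x : EuclideanSpace ℝ (Fin n)) :
    partialDeriv a φ x
      = fderiv ℝ (partialDeriv (Fin.tail a) φ) x (EuclideanSpace.single (a 0) (1 : ℝ)) := by
  have h1 : ContDiff ℝ ∞ (iteratedFDeriv ℝ k φ) :=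
    h.iteratedFDeriv_right (m := ∞) (by exact_mod_cast le_top)
  have h2 := (ContinuousMultilinearMap.apply ℝ (fun _ : Fin k => EuclideanSpace ℝ (Fin n)) ℝ
    (fun i => EuclideanSpace.single (Fin.tail a i) (1 : ℝ))).hasFDerivAt.comp x
      (h1.differentiable (by simp) x).hasFDerivAt
  have h3 : fderiv ℝ (partialDeriv (Fin.tail a) φ) x = _ := h2.fderiv
  rw [h3, partialDeriv, iteratedFDeriv_succ_apply_left]
  rfl

/-- The derivatives of a mollification fall on the kernel. -/
theorem partialDeriv_convolution {n k : ℕ} (a : Fin k → Fin n)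
    {u φ : EuclideanSpace ℝ (Fin n) → ℝ} (hu : LocallyIntegrable u volume)
    (hφ : ContDiff ℝ ∞ φ) (hc : HasCompactSupport φ) :
    partialDeriv a (u ⋆[ContinuousLinearMap.lsmul ℝ ℝ, volume] φ)
      = u ⋆[ContinuousLinearMap.lsmul ℝ ℝ, volume] partialDeriv a φ := by
  induction k with
  | zero => 
    have : ∀ f : EuclideanSpace ℝ (Fin n) → ℝ, partialDeriv a f = f := fun f => by
      ext x; simp [partialDeriv]
    rw [this, this]
  | succ k ih =>
    have hcd : ContDiff ℝ ∞ (u ⋆[ContinuousLinearMap.lsmul ℝ ℝ, volume] φ) :=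
      hc.contDiff_convolution_right _ hu hφ
    have hct := hc.partialDeriv (Fin.tail a)
    have hdt : ContDiff ℝ 1 (partialDeriv (Fin.tail a) φ) :=
      (ContDiff.partialDeriv (Fin.tail a) hφ).of_le (by exact_mod_cast le_top)
    ext x
    rw [partialDeriv_succ a hcd, ih (Fin.tail a),
      (hct.hasFDerivAt_convolution_right _ hu hdt x).fderiv,
      convolution_precompR_apply _ hu (hct.fderiv (𝕜 := ℝ)) (hdt.continuous_fderiv one_ne_zero)]
    congr 1
    ext y
    exact (partialDeriv_succ a hφ y).symm

/-- Derivatives of a reflected and translated kernel. -/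
theorem partialDeriv_comp_const_sub {n k : ℕ} (a : Fin k → Fin n)
    {φ : EuclideanSpace ℝ (Fin n) → ℝ} (hφ : ContDiff ℝ ∞ φ) (x y : EuclideanSpace ℝ (Fin n)) :
    partialDeriv a (fun z => φ (x - z)) y = (-1) ^ k * partialDeriv a φ (x - y) := by
  induction k generalizing y with
  | zero => simp [partialDeriv]
  | succ k ih =>
    have h1 : ContDiff ℝ ∞ (fun z => φ (x - z)) := hφ.comp (contDiff_const.sub contDiff_id)
    have hd : DifferentiableAt ℝ (partialDeriv (Fin.tail a) φ) (x - y) :=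
      (ContDiff.partialDeriv (Fin.tail a) hφ).differentiable (by simp) _
    have h2 : HasFDerivAt (fun z => (-1) ^ k * partialDeriv (Fin.tail a) φ (x - z))
        (((-1 : ℝ)) ^ k • (fderiv ℝ (partialDeriv (Fin.tail a) φ) (x - y)).comp
          (-ContinuousLinearMap.id ℝ (EuclideanSpace ℝ (Fin n)))) y :=
      (hd.hasFDerivAt.comp y ((hasFDerivAt_id y).const_sub x)).const_mul _
    rw [partialDeriv_succ a h1, funext (ih (Fin.tail a)), h2.fderiv, partialDeriv_succ a hφ]
    simp [pow_succ]

/-- The derivatives of a mollification are bounded by the weak derivatives. -/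
theorem abs_partialDeriv_convolution_le {n k : ℕ} {a : Fin k → Fin n}
    {u g φ : EuclideanSpace ℝ (Fin n) → ℝ} (hug : IsWeakDeriv a u g)
    (hφ : ContDiff ℝ ∞ φ) (hc : HasCompactSupport φ) (h0 : ∀ y, 0 ≤ φ y)
    (h1 : ∫ y, φ y = 1) {G : ℝ} (hG : ∀ᵐ y, |g y| ≤ G) (x : EuclideanSpace ℝ (Fin n)) :
    |partialDeriv a (u ⋆[ContinuousLinearMap.lsmul ℝ ℝ, volume] φ) x| ≤ G := by
  obtain ⟨hu, hg, hw⟩ := hug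
  have hχ : ContDiff ℝ ∞ (fun z => φ (x - z)) := hφ.comp (contDiff_const.sub contDiff_id)
  have hχc : HasCompactSupport (fun z => φ (x - z)) :=
    hc.comp_homeomorph (Homeomorph.subLeft x)
  rw [partialDeriv_convolution a hu hφ hc]
  have h2 : (u ⋆[ContinuousLinearMap.lsmul ℝ ℝ, volume] partialDeriv a φ) x
      = ∫ z, g z * φ (x - z) := by
    have h3 := hw _ hχ hχc
    simp_rw [partialDeriv_comp_const_sub a hφ] at h3
    have h4 : ∀ z, u z * ((-1) ^ k * partialDeriv a φ (x - z))
        = (-1) ^ k * (u z * partialDeriv a φ (x - z)) := fun z => by ring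
    simp_rw [h4] at h3
    rw [integral_const_mul] at h3
    exact mul_left_cancel₀ (pow_ne_zero k (by norm_num : (-1 : ℝ) ≠ 0)) h3
  rw [h2]
  have h5 : Integrable (fun z => G * φ (x - z)) volume :=
    (hχ.continuous.integrable_of_hasCompactSupport hχc).const_mul G
  calc |∫ z, g z * φ (x - z)| ≤ ∫ z, G * φ (x - z) := by
        rw [← Real.norm_eq_abs]
        refine norm_integral_le_of_norm_le h5 ?_
        filter_upwards [hG] with z hz
        rw [norm_mul, Real.norm_eq_abs, Real.norm_eq_abs, abs_of_nonneg (h0 _)]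
        exact mul_le_mul_of_nonneg_right hz (h0 _)
    _ = G := by rw [integral_const_mul, integral_sub_left_eq_self (μ := volume) φ x, h1, mul_one]

/-- Weak derivatives are unique, so those of a function in the Sobolev space are bounded by
`gradNorm`. -/
theorem exists_isWeakDeriv_ae_le_gradNorm {n N : ℕ} {u : EuclideanSpace ℝ (Fin n) → ℝ}
    (hu : MemSobolevInfty N u) (a : Fin N → Fin n) :
    ∃ g, IsWeakDeriv a u g ∧ ∀ᵐ y, |g y| ≤ gradNorm N u := by
  have hex : ∀ b : Fin N → Fin n, ∃ g, IsWeakDeriv b u g := fun b =>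
    (hu.2 N le_rfl b).imp fun _ h => h.2
  have hwd : ∀ b : Fin N → Fin n, IsWeakDeriv b u (weakDeriv b u) := fun b => by
    rw [weakDeriv, dif_pos (hex b)]
    exact (hex b).choose_spec
  have hmem : ∀ b : Fin N → Fin n, MemLp (weakDeriv b u) ⊤ volume := fun b => by
    obtain ⟨g, hg, hbg⟩ := hu.2 N le_rfl b
    refine (memLp_congr_ae ?_).mp hg
    refine ae_eq_of_integral_contDiff_smul_eq hbg.2.1 (hwd b).2.1 fun φ hφ hc => ?_
    have h1 := hbg.2.2 φ hφ hc
    have h2 := (hwd b).2.2 φ hφ hc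
    have := mul_left_cancel₀ (pow_ne_zero N (by norm_num : (-1 : ℝ) ≠ 0)) (h1.symm.trans h2)
    simpa only [smul_eq_mul, mul_comm] using this
  refine ⟨weakDeriv a u, hwd a, ?_⟩
  set S : EuclideanSpace ℝ (Fin n) → ℝ :=
    fun x => Real.sqrt (∑ b : Fin N → Fin n, weakDeriv b u x ^ 2) with hS
  have hbd : ∀ y, S y ≤ ∑ b : Fin N → Fin n, |weakDeriv b u y| := fun y => by
    rw [hS]
    refine Real.sqrt_le_iff.mpr ⟨by positivity, ?_⟩
    calc ∑ b : Fin N → Fin n, weakDeriv b u y ^ 2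
        = ∑ b : Fin N → Fin n, |weakDeriv b u y| ^ 2 := by simp
      _ ≤ _ := Finset.sum_sq_le_sq_sum_of_nonneg fun _ _ => abs_nonneg _
  have hSm : MemLp S ⊤ volume := by
    have h1 : MemLp (fun y => ∑ b : Fin N → Fin n, |weakDeriv b u y|) ⊤ volume :=
      memLp_finsetSum _ fun b _ => (hmem b).abs
    refine h1.mono ?_ (Filter.Eventually.of_forall fun y => ?_)
    · exact Real.continuous_sqrt.comp_aestronglyMeasurable
        (Finset.aestronglyMeasurable_fun_sum _ fun b _ => (hmem b).1.pow 2)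
    · rw [Real.norm_eq_abs, Real.norm_eq_abs, abs_of_nonneg (Real.sqrt_nonneg _)]
      exact (hbd y).trans (le_abs_self _)
  have hfin : eLpNorm S ⊤ volume ≠ ⊤ := hSm.2.ne
  have hle : ∀ᵐ y, ‖S y‖ₑ ≤ eLpNorm S ⊤ volume := by
    rw [eLpNorm_exponent_top]
    exact ae_le_eLpNormEssSup
  filter_upwards [hle] with y hy
  have h1 : ‖S y‖ ≤ gradNorm N u := by
    have := ENNReal.toReal_mono hfin hy
    simpa [gradNorm, hS] using this
  refine le_trans ?_ ((le_abs_self _).trans h1)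
  rw [← Real.sqrt_sq_eq_abs]
  exact Real.sqrt_le_sqrt (Finset.single_le_sum (f := fun b => weakDeriv b u y ^ 2)
    (fun b _ => sq_nonneg _) (Finset.mem_univ a))

/-- A combination of point values that annihilates the polynomials of degree `< N` is bounded on
`W^N_∞` by `‖∇_N u‖_∞`. -/
theorem abs_sum_le_gradNorm_of_annihilates {n N : ℕ} (hN : 1 ≤ N)
    {u : EuclideanSpace ℝ (Fin n) → ℝ} (huc : Continuous u) (hu : MemSobolevInfty N u)
    {κ : Type*} (s : Finset κ) (w : κ → ℝ) (z : κ → EuclideanSpace ℝ (Fin n))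
    (x : EuclideanSpace ℝ (Fin n))
    (hann : ∀ α : Fin n → ℕ, ∑ i, α i < N → ∑ k ∈ s, w k * ∏ i, (z k - x) i ^ α i = 0) :
    |∑ k ∈ s, w k * u (z k)|
      ≤ (n ^ N : ℝ) * gradNorm N u * ∑ k ∈ s, |w k| * ‖z k - x‖ ^ N := by
  let φ : ℕ → ContDiffBump (0 : EuclideanSpace ℝ (Fin n)) := fun i =>
    ⟨1 / (i + 1 : ℝ) / 2, 1 / (i + 1 : ℝ), by positivity, half_lt_self (by positivity)⟩
  have hφ : Filter.Tendsto (fun i => (φ i).rOut) Filter.atTop (nhds 0) :=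
    tendsto_one_div_add_atTop_nhds_zero_nat
  have hlim : ∀ y, Filter.Tendsto (fun i => (u ⋆[ContinuousLinearMap.lsmul ℝ ℝ, volume]
      (φ i).normed volume) y) Filter.atTop (nhds (u y)) := fun y => by
    refine (ContDiffBump.convolution_tendsto_right_of_continuous (μ := volume) hφ huc y).congr
      fun i => ?_
    rw [← convolution_flip]
    congr 1
    ext
    simp
  have hlim' : Filter.Tendsto (fun i => |∑ k ∈ s, w k *
      (u ⋆[ContinuousLinearMap.lsmul ℝ ℝ, volume] (φ i).normed volume) (z k)|) Filter.atTop
      (nhds |∑ k ∈ s, w k * u (z k)|) :=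
    (tendsto_finsetSum _ fun k _ => (hlim (z k)).const_mul (w k)).abs
  refine le_of_tendsto hlim' (Filter.Eventually.of_forall fun i => ?_)
  refine abs_sum_le_of_annihilates_of_contDiff hN
    ((φ i).hasCompactSupport_normed.contDiff_convolution_right _ huc.locallyIntegrable
      (φ i).contDiff_normed) (fun a y => ?_) s w z x hann
  obtain ⟨g, hg, hgG⟩ := exists_isWeakDeriv_ae_le_gradNorm hu a
  exact abs_partialDeriv_convolution_le hg (φ i).contDiff_normed (φ i).hasCompactSupport_normed
    (fun y => (φ i).nonneg_normed y) (φ i).integral_normed hgG y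

/-! ### Local polynomial reproduction on the stars -/

/-- The monomial with exponent `β`. -/
noncomputable def monomialOf {n : ℕ} (β : Fin n → ℕ) : MvPolynomial (Fin n) ℝ :=
  ∏ i, MvPolynomial.X i ^ β i

theorem eval_monomialOf {n : ℕ} (β : Fin n → ℕ) (t : Fin n → ℝ) :
    MvPolynomial.eval t (monomialOf β) = ∏ i, t i ^ β i := by
  simp [monomialOf]

theorem totalDegree_monomialOf_le {n : ℕ} (β : Fin n → ℕ) :
    (monomialOf β).totalDegree ≤ ∑ i, β i :=
  (MvPolynomial.totalDegree_finsetProd _ _).trans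
    (Finset.sum_le_sum fun i _ => (MvPolynomial.totalDegree_X_pow i (β i)).le)

theorem abs_eval_monomialOf_le {n N : ℕ} {β : Fin n → ℕ} (hβ : ∑ i, β i ≤ N)
    (t : EuclideanSpace ℝ (Fin n)) :
    |MvPolynomial.eval (fun i => t i) (monomialOf β)| ≤ (1 + ‖t‖) ^ N := by
  rw [eval_monomialOf, Finset.abs_prod]
  calc ∏ i, |t i ^ β i| ≤ ∏ i, (1 + ‖t‖) ^ β i := by
        refine Finset.prod_le_prod (fun _ _ => abs_nonneg _) fun i _ => ?_
        rw [abs_pow]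
        have : |t i| ≤ ‖t‖ := by simpa using PiLp.norm_apply_le t i
        exact pow_le_pow_left₀ (abs_nonneg _) (by linarith) _
    _ = (1 + ‖t‖) ^ ∑ i, β i := Finset.prod_pow_eq_pow_sum _ _ _
    _ ≤ (1 + ‖t‖) ^ N := pow_le_pow_right₀ (by linarith [norm_nonneg t]) hβ

/-- The polynomial `∑_β (V⁻¹)_{βα} t^β`: together with `1` and its companions it is the Lagrange
basis that belongs to the Vandermonde matrix `V`. -/
noncomputable def lagrangeOf {n N : ℕ} (V : Matrix (multiIdx n N) (multiIdx n N) ℝ)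
    (α : multiIdx n N) : MvPolynomial (Fin n) ℝ :=
  ∑ β, MvPolynomial.C (V⁻¹ β α) * monomialOf β.1

theorem sum_le_of_mem_multiIdx {n N : ℕ} (β : multiIdx n N) : ∑ i, β.1 i ≤ N :=
  (Finset.mem_filter.mp β.2).2.2.le

theorem totalDegree_lagrangeOf_le {n N : ℕ} (V : Matrix (multiIdx n N) (multiIdx n N) ℝ)
    (α : multiIdx n N) : (lagrangeOf V α).totalDegree ≤ N := by
  refine MvPolynomial.totalDegree_finsetSum_le fun β _ => ?_
  refine (MvPolynomial.totalDegree_mul _ _).trans ?_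
  rw [MvPolynomial.totalDegree_C, zero_add]
  exact (totalDegree_monomialOf_le _).trans (sum_le_of_mem_multiIdx β)

theorem eval_lagrangeOf {n N : ℕ} (V : Matrix (multiIdx n N) (multiIdx n N) ℝ)
    (α : multiIdx n N) (t : Fin n → ℝ) :
    MvPolynomial.eval t (lagrangeOf V α) = ∑ β, V⁻¹ β α * ∏ i, t i ^ β.1 i := by
  simp [lagrangeOf, eval_monomialOf]

/-- Cramer's rule bounds the inverse of a matrix with entries at most one. -/
theorem abs_inv_apply_le {m : Type*} [Fintype m] [DecidableEq m] {V : Matrix m m ℝ} {c : ℝ}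
    (hc : 0 < c) (hdet : c ≤ |V.det|) (hV : ∀ i j, |V i j| ≤ 1) (i j : m) :
    |V⁻¹ i j| ≤ (Fintype.card m).factorial / c := by
  have hadj : |V.adjugate i j| ≤ (Fintype.card m).factorial := by
    rw [Matrix.adjugate_apply]
    have := Matrix.det_le (A := V.updateRow j (Pi.single i 1)) (abv := AbsoluteValue.abs) (x := 1)
      fun a b => by
        change |V.updateRow j (Pi.single i 1) a b| ≤ 1
        rw [Matrix.updateRow_apply]
        split_ifs
        · rw [Pi.single_apply]; split_ifs <;> simp
        · exact hV a b
    simpa using this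
  rw [Matrix.inv_def, Matrix.smul_apply, smul_eq_mul, Ring.inverse_eq_inv', abs_mul, abs_inv,
    inv_mul_eq_div]
  exact div_le_div₀ (by positivity) hadj hc hdet

/-- The sum over the Lagrange basis reproduces the monomials of degree between `1` and `N - 1`. -/
theorem sum_eval_lagrangeOf_mul {n N : ℕ} {V : Matrix (multiIdx n N) (multiIdx n N) ℝ}
    (hdet : V.det ≠ 0) (t : Fin n → ℝ) (γ : multiIdx n N) :
    ∑ α, MvPolynomial.eval t (lagrangeOf V α) * V α γ = ∏ i, t i ^ γ.1 i := by
  simp_rw [eval_lagrangeOf, Finset.sum_mul]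
  rw [Finset.sum_comm]
  have h1 : ∀ β : multiIdx n N, ∑ α, V⁻¹ β α * (∏ i, t i ^ β.1 i) * V α γ
      = (∏ i, t i ^ β.1 i) * (1 : Matrix (multiIdx n N) (multiIdx n N) ℝ) β γ := fun β => by
    rw [← Matrix.nonsing_inv_mul V (isUnit_iff_ne_zero.mpr hdet), Matrix.mul_apply,
      Finset.mul_sum]
    exact Finset.sum_congr rfl fun α _ => by ring
  rw [Finset.sum_congr rfl fun β _ => h1 β]
  simp [Matrix.one_apply]

theorem abs_vandermondeStar_le_one {n N : ℕ} {ι : Type*} {x : ι → EuclideanSpace ℝ (Fin n)}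
    {h : ι → ℝ} {j : ι} (hj : 0 < h j) {e : multiIdx n N → ι}
    (he : ∀ α, x (e α) ∈ Metric.ball (x j) (h j)) (α β : multiIdx n N) :
    |vandermondeStar N x h j e α β| ≤ 1 := by
  rw [vandermondeStar, Matrix.of_apply, Finset.abs_prod]
  refine Finset.prod_le_one (fun _ _ => abs_nonneg _) fun i _ => ?_
  rw [abs_pow]
  refine pow_le_one₀ (abs_nonneg _) ?_
  rw [abs_div, abs_of_pos hj, div_le_one hj]
  have h1 : |(x (e α) - x j) i| ≤ ‖x (e α) - x j‖ := by
    simpa using PiLp.norm_apply_le (x (e α) - x j) i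
  exact h1.trans (mem_ball_iff_norm.mp (he α)).le

/-- The interpolation functional on a star minus the evaluation at `x_j + h_j t` annihilates the
monomials of degree `< N` centred at `x_j`. -/
theorem star_functional_annihilates {n N : ℕ} {ι : Type*} {x : ι → EuclideanSpace ℝ (Fin n)}
    {h : ι → ℝ} {j : ι} (hj : 0 < h j) {e : multiIdx n N → ι}
    (hdet : (vandermondeStar N x h j e).det ≠ 0) (t : EuclideanSpace ℝ (Fin n))
    {l : multiIdx n N → ℝ}
    (hl : ∀ α, l α = MvPolynomial.eval (fun i => t i) (lagrangeOf (vandermondeStar N x h j e) α))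
    {γ : Fin n → ℕ} (hγ : ∑ i, γ i < N) :
    -1 * ∏ i, (x j + h j • t - x j) i ^ γ i + ((1 - ∑ α, l α) * ∏ i, (x j - x j) i ^ γ i
      + ∑ α, l α * ∏ i, (x (e α) - x j) i ^ γ i) = 0 := by
  have hy : ∀ i, (x j + h j • t - x j) i = h j * t i := fun i => by simp
  simp_rw [hy, mul_pow]
  rw [Finset.prod_mul_distrib, Finset.prod_pow_eq_pow_sum]
  rcases Nat.eq_zero_or_pos (∑ i, γ i) with h0 | h0
  · have hγ0 : ∀ i, γ i = 0 := fun i => by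
      simpa using (Finset.sum_eq_zero_iff.mp h0) i (Finset.mem_univ i)
    simp [hγ0]
  · have hγm : γ ∈ multiIdx n N := by
      refine Finset.mem_filter.mpr ⟨Fintype.mem_piFinset.mpr fun i => ?_, h0, hγ⟩
      exact Finset.mem_range.mpr
        ((Finset.single_le_sum (fun _ _ => Nat.zero_le _) (Finset.mem_univ i)).trans_lt hγ)
    obtain ⟨i, -, hi⟩ : ∃ i ∈ Finset.univ, γ i ≠ 0 := Finset.exists_ne_zero_of_sum_ne_zero h0.ne'
    have hxx : ∏ i, (x j - x j) i ^ γ i = 0 :=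
      Finset.prod_eq_zero (Finset.mem_univ i) (by simp [hi])
    have hVγ : ∀ α, ∏ i, (x (e α) - x j) i ^ γ i
        = h j ^ (∑ i, γ i) * vandermondeStar N x h j e α ⟨γ, hγm⟩ := by
      intro α
      rw [vandermondeStar, Matrix.of_apply, ← Finset.prod_pow_eq_pow_sum,
        ← Finset.prod_mul_distrib]
      refine Finset.prod_congr rfl fun i _ => ?_
      rw [← mul_pow, mul_div_cancel₀ _ hj.ne']
      rfl
    have hrep := sum_eval_lagrangeOf_mul hdet (fun i => t i) ⟨γ, hγm⟩
    simp_rw [← hl] at hrep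
    simp_rw [hxx, hVγ]
    rw [← hrep, mul_zero, zero_add, Finset.mul_sum, Finset.mul_sum, ← Finset.sum_add_distrib]
    exact Finset.sum_eq_zero fun α _ => by ring

/-- The error of the interpolation on a star in terms of the Lebesgue sum `∑ |l_α|`. -/
theorem abs_star_interpolation_sub_le {n N : ℕ} (hN : 1 ≤ N) {ι : Type*}
    {x : ι → EuclideanSpace ℝ (Fin n)} {h : ι → ℝ} {j : ι} (hj : 0 < h j)
    {e : multiIdx n N → ι} (he : ∀ α, x (e α) ∈ Metric.ball (x j) (h j))
    (hdet : (vandermondeStar N x h j e).det ≠ 0) {t : EuclideanSpace ℝ (Fin n)}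
    {l : multiIdx n N → ℝ}
    (hl : ∀ α, l α = MvPolynomial.eval (fun i => t i) (lagrangeOf (vandermondeStar N x h j e) α))
    {u : EuclideanSpace ℝ (Fin n) → ℝ} (huc : Continuous u) (hu : MemSobolevInfty N u) :
    |-1 * u (x j + h j • t) + ((1 - ∑ α, l α) * u (x j) + ∑ α, l α * u (x (e α)))|
      ≤ (n : ℝ) ^ N * gradNorm N u * (h j ^ N * ((1 + ‖t‖) ^ N + ∑ α, |l α|)) := by
  -- the functional has weights at `y = x_j + h_j t`, at `x_j` and on the star
  have key := abs_sum_le_gradNorm_of_annihilates hN huc hu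
    (Finset.univ : Finset (Option (Option (multiIdx n N))))
    (fun k => k.elim (-1) fun k => k.elim (1 - ∑ α, l α) l)
    (fun k => k.elim (x j + h j • t) fun k => k.elim (x j) fun α => x (e α)) (x j)
    (fun γ hγ => by
      simp only [Fintype.sum_option, Option.elim]
      exact star_functional_annihilates hj hdet t hl hγ)
  simp only [Fintype.sum_option, Option.elim] at key
  refine key.trans ?_
  have hxj : ‖x j - x j‖ ^ N = 0 := by
    rw [sub_self, norm_zero, zero_pow (by omega)]
  have hG0 : 0 ≤ gradNorm N u := ENNReal.toReal_nonneg
  have hj0 := hj.le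
  rw [hxj, mul_zero, zero_add, abs_neg, abs_one, one_mul, mul_add (h j ^ N), Finset.mul_sum,
    add_sub_cancel_left, norm_smul, Real.norm_eq_abs, abs_of_pos hj, mul_pow]
  refine mul_le_mul_of_nonneg_left (add_le_add ?_ (Finset.sum_le_sum fun α _ => ?_)) (by positivity)
  · gcongr
    linarith
  · rw [mul_comm]
    gcongr
    exact (mem_ball_iff_norm.mp (he α)).le

/-- Star interpolation: polynomials on the star of `x_j`, with values bounded in terms of the
Vandermonde constant only, whose linear functional `u ↦ ∑ Λ_k(t) u(x_k)` is a local approximation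
of order `N` to the point evaluation at `y = x_j + h_j t`. -/
theorem exists_star_interpolation {n N : ℕ} (hN : 1 ≤ N) {ι : Type*}
    [DecidableEq ι] {x : ι → EuclideanSpace ℝ (Fin n)} {h : ι → ℝ} {st : ι → Finset ι} {cV : ℝ}
    (hcV : 0 < cV) (hh : ∀ j, 0 < h j) (hst : StarCondition N cV x h st) {D : ℝ}
    (hD : D = ((n : ℝ) ^ N + 1) * (1 + 2 * ((Fintype.card (multiIdx n N) : ℝ) ^ 2 *
      ((Fintype.card (multiIdx n N)).factorial / cV)))) (j : ι) :
    ∃ Λ : ι → MvPolynomial (Fin n) ℝ,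
      (∀ k, k ∉ insert j (st j) → Λ k = 0) ∧ (∀ k, (Λ k).totalDegree ≤ N) ∧
      (∀ t : EuclideanSpace ℝ (Fin n),
        ∑ k ∈ insert j (st j), |MvPolynomial.eval (fun i => t i) (Λ k)| ≤ D * (1 + ‖t‖) ^ N) ∧
      ∀ u : EuclideanSpace ℝ (Fin n) → ℝ, Continuous u → MemSobolevInfty N u →
        ∀ t : EuclideanSpace ℝ (Fin n),
          |∑ k ∈ insert j (st j), MvPolynomial.eval (fun i => t i) (Λ k) * u (x k)
            - u (x j + h j • t)| ≤ D * gradNorm N u * h j ^ N * (1 + ‖t‖) ^ N := by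
  obtain ⟨hball, e, hdet⟩ := hst j
  set m : ℝ := (Fintype.card (multiIdx n N) : ℝ) with hm
  set b : ℝ := (Fintype.card (multiIdx n N)).factorial / cV with hb
  have hb0 : 0 ≤ b := by positivity
  set V := vandermondeStar N x h j fun α => (e α : ι) with hV
  have hball' : ∀ α, x (e α) ∈ Metric.ball (x j) (h j) := fun α => hball _ (e α).2
  have hV1 : ∀ α β, |V α β| ≤ 1 := abs_vandermondeStar_le_one (hh j) hball'
  have hdet0 : V.det ≠ 0 := fun h0 => by rw [h0, abs_zero] at hdet; linarith
  -- a star containing its centre would give a vanishing row of the Vandermonde matrix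
  have hjst : j ∉ st j := fun hmem => by
    refine hdet0 (Matrix.det_eq_zero_of_row_eq_zero (e.symm ⟨j, hmem⟩) fun β => ?_)
    rw [hV, vandermondeStar, Matrix.of_apply]
    obtain ⟨i, hi⟩ : ∃ i, β.1 i ≠ 0 := by
      by_contra! h0
      have := (Finset.mem_filter.mp β.2).2.1
      simp [h0] at this
    exact Finset.prod_eq_zero (Finset.mem_univ i) (by simp [hi])
  set ℓ := lagrangeOf V with hℓ
  have hℓle : ∀ α (t : EuclideanSpace ℝ (Fin n)),
      |MvPolynomial.eval (fun i => t i) (ℓ α)| ≤ m * b * (1 + ‖t‖) ^ N := fun α t => by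
    rw [hℓ, eval_lagrangeOf]
    refine (Finset.abs_sum_le_sum_abs _ _).trans ?_
    calc ∑ β : multiIdx n N, |V⁻¹ β α * ∏ i, t i ^ β.1 i|
        ≤ ∑ _β : multiIdx n N, b * (1 + ‖t‖) ^ N := by
          refine Finset.sum_le_sum fun β _ => ?_
          rw [abs_mul]
          refine mul_le_mul (abs_inv_apply_le hcV hdet hV1 β α) ?_ (abs_nonneg _) hb0
          have := abs_eval_monomialOf_le (sum_le_of_mem_multiIdx β) t
          rwa [eval_monomialOf] at this
      _ = m * b * (1 + ‖t‖) ^ N := by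
          rw [Finset.sum_const, Finset.card_univ, nsmul_eq_mul]; ring
  have hℓsum : ∀ t : EuclideanSpace ℝ (Fin n),
      ∑ α, |MvPolynomial.eval (fun i => t i) (ℓ α)| ≤ m ^ 2 * b * (1 + ‖t‖) ^ N := fun t => by
    refine (Finset.sum_le_sum fun α _ => hℓle α t).trans_eq ?_
    rw [Finset.sum_const, Finset.card_univ, nsmul_eq_mul]; ring
  have hone : ∀ t : EuclideanSpace ℝ (Fin n), (1 : ℝ) ≤ (1 + ‖t‖) ^ N := fun t =>
    one_le_pow₀ (by linarith [norm_nonneg t])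
  let Λ : ι → MvPolynomial (Fin n) ℝ := fun k =>
    if k = j then 1 - ∑ α, ℓ α else if hk : k ∈ st j then ℓ (e.symm ⟨k, hk⟩) else 0
  have hΛj : Λ j = 1 - ∑ α, ℓ α := if_pos rfl
  have hΛe : ∀ α, Λ (e α) = ℓ α := fun α => by
    have h1 : (e α : ι) ≠ j := fun h0 => by
      have h2 := (e α).2
      rw [h0] at h2
      exact hjst h2
    simp only [Λ, if_neg h1, dif_pos (e α).2, Subtype.coe_eta, Equiv.symm_apply_apply]
  have hsum : ∀ f : ι → ℝ, ∑ k ∈ insert j (st j), f k = f j + ∑ α, f (e α) := fun f => by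
    rw [Finset.sum_insert hjst, ← Finset.sum_coe_sort, ← e.sum_comp]
  refine ⟨Λ, fun k hk => ?_, fun k => ?_, fun t => ?_, fun u huc hu t => ?_⟩
  · rw [Finset.mem_insert, not_or] at hk
    simp only [Λ, if_neg hk.1, dif_neg hk.2]
  · simp only [Λ]
    split_ifs
    · refine (MvPolynomial.totalDegree_sub _ _).trans (max_le (by simp) ?_)
      exact MvPolynomial.totalDegree_finsetSum_le fun α _ => totalDegree_lagrangeOf_le V α
    · exact totalDegree_lagrangeOf_le V _
    · simp
  · rw [hsum, hΛj]
    simp_rw [hΛe]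
    have h1 : |MvPolynomial.eval (fun i => t i) (1 - ∑ α, ℓ α)|
        ≤ 1 + ∑ α, |MvPolynomial.eval (fun i => t i) (ℓ α)| := by
      rw [map_sub, map_one, map_sum]
      refine (abs_sub _ _).trans ?_
      rw [abs_one]
      exact add_le_add_right (Finset.abs_sum_le_sum_abs _ _) _
    calc _ ≤ (1 + m ^ 2 * b * (1 + ‖t‖) ^ N) + m ^ 2 * b * (1 + ‖t‖) ^ N :=
          add_le_add (h1.trans (add_le_add_right (hℓsum t) _)) (hℓsum t)
      _ ≤ 1 * ((1 + 2 * (m ^ 2 * b)) * (1 + ‖t‖) ^ N) := by linarith [hone t]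
      _ ≤ ((n : ℝ) ^ N + 1) * ((1 + 2 * (m ^ 2 * b)) * (1 + ‖t‖) ^ N) := by
          gcongr
          exact le_add_of_nonneg_left (by positivity)
      _ = D * (1 + ‖t‖) ^ N := by rw [hD]; ring
  · have hG0 : 0 ≤ gradNorm N u := ENNReal.toReal_nonneg
    have hj0 := (hh j).le
    have key := abs_star_interpolation_sub_le hN (hh j) hball' hdet0 (t := t)
      (l := fun α => MvPolynomial.eval (fun i => t i) (ℓ α)) (fun α => rfl) huc hu
    rw [hsum, hΛj, map_sub, map_one, map_sum]
    simp_rw [hΛe]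
    rw [sub_eq_neg_add, ← neg_one_mul]
    refine key.trans ?_
    calc (n : ℝ) ^ N * gradNorm N u * (h j ^ N * ((1 + ‖t‖) ^ N
          + ∑ α, |MvPolynomial.eval (fun i => t i) (ℓ α)|))
        ≤ ((n : ℝ) ^ N + 1) * gradNorm N u * (h j ^ N * ((1 + ‖t‖) ^ N
          + 2 * (m ^ 2 * b * (1 + ‖t‖) ^ N))) := by
          gcongr
          · exact le_add_of_nonneg_right zero_le_one
          · refine (hℓsum t).trans (le_mul_of_one_le_left (by positivity) one_le_two)
      _ = D * gradNorm N u * h j ^ N * (1 + ‖t‖) ^ N := by rw [hD]; ring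

/-! ### Sums over the nodes -/

theorem forall_of_ae_of_isClosed {n : ℕ} {q : EuclideanSpace ℝ (Fin n) → Prop}
    (hcl : IsClosed {y | q y}) (hae : ∀ᵐ y, q y) (y : EuclideanSpace ℝ (Fin n)) : q y := by
  have : {y | q y} = Set.univ := by
    rw [← hcl.closure_eq]; exact (Measure.dense_of_ae hae).closure_eq
  exact (this ▸ Set.mem_univ y : y ∈ {y | q y})

/-- The sums in `gridNorm` are lower semicontinuous, so that an essential bound holds everywhere. -/
theorem summable_and_tsum_le_of_gridNorm_le {n : ℕ} {ι : Type*} {x : ι → EuclideanSpace ℝ (Fin n)}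
    {h : ι → ℝ} (hh : ∀ j, 0 < h j) {s c : ℝ} (hs : gridNorm x h s ≤ ENNReal.ofReal c)
    (y : EuclideanSpace ℝ (Fin n)) :
    (Summable fun j => (1 + ‖(h j)⁻¹ • (y - x j)‖) ^ s) ∧
      ∑' j, (1 + ‖(h j)⁻¹ • (y - x j)‖) ^ s ≤ max c 0 := by
  set F : EuclideanSpace ℝ (Fin n) → ENNReal :=
    fun y => ∑' j, ENNReal.ofReal ((1 + (h j)⁻¹ * ‖y - x j‖) ^ s) with hF
  have hlsc : LowerSemicontinuous F := lowerSemicontinuous_tsum fun j => by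
    refine Continuous.lowerSemicontinuous (ENNReal.continuous_ofReal.comp ?_)
    refine Continuous.rpow_const (by fun_prop) fun y => Or.inl ?_
    have := (hh j).le
    positivity
  have hae : ∀ᵐ y, F y ≤ ENNReal.ofReal c :=
    (ENNReal.ae_le_essSup F).mono fun y hy => hy.trans hs
  have hall : F y ≤ ENNReal.ofReal c :=
    forall_of_ae_of_isClosed (hlsc.isClosed_preimage _) hae y
  have hnorm : ∀ j, (h j)⁻¹ * ‖y - x j‖ = ‖(h j)⁻¹ • (y - x j)‖ := fun j => by
    rw [norm_smul, Real.norm_eq_abs, abs_of_pos (inv_pos.mpr (hh j))]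
  simp only [hF, hnorm] at hall
  have hne : ∑' j, ENNReal.ofReal ((1 + ‖(h j)⁻¹ • (y - x j)‖) ^ s) ≠ ⊤ :=
    (hall.trans_lt ENNReal.ofReal_lt_top).ne
  have hpos : ∀ j, 0 ≤ (1 + ‖(h j)⁻¹ • (y - x j)‖) ^ s := fun j => by positivity
  have hsum : Summable fun j => (1 + ‖(h j)⁻¹ • (y - x j)‖) ^ s := by
    have := ENNReal.summable_toReal hne
    simpa only [ENNReal.toReal_ofReal (hpos _)] using this
  refine ⟨hsum, ?_⟩
  rw [← ENNReal.ofReal_tsum_of_nonneg hpos hsum] at hall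
  by_cases hc : 0 ≤ c
  · exact ((ENNReal.ofReal_le_ofReal_iff hc).mp hall).trans (le_max_left _ _)
  · rw [ENNReal.ofReal_of_nonpos (not_le.mp hc).le, nonpos_iff_eq_zero,
      ENNReal.ofReal_eq_zero] at hall
    exact hall.trans (le_max_right _ _)

/-- The decay of the gradient gives a Lipschitz bound with the same decay. -/
theorem abs_sub_le_of_norm_fderiv_decay {n : ℕ} {η : EuclideanSpace ℝ (Fin n) → ℝ} {K c : ℝ}
    (hK : 0 < K) (hη : ContDiff ℝ 1 η) (hd : ∀ y, (1 + ‖y‖) ^ K * ‖fderiv ℝ η y‖ ≤ c)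
    {a b : EuclideanSpace ℝ (Fin n)} (hab : ‖a - b‖ ≤ 1) :
    |η a - η b| ≤ c * 2 ^ K * (1 + ‖b‖) ^ (-K) * ‖a - b‖ := by
  have hc0 : 0 ≤ c := le_trans (by positivity) (hd 0)
  have hbd : ∀ z ∈ segment ℝ b a, ‖fderiv ℝ η z‖ ≤ c * 2 ^ K * (1 + ‖b‖) ^ (-K) := by
    intro z hz
    have h1 : ‖z - b‖ ≤ 1 := by
      have := norm_sub_le_of_mem_segment hz
      exact this.trans hab
    have h2 : ‖b‖ ≤ ‖z‖ + 1 := by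
      have := norm_sub_norm_le b z
      rw [norm_sub_rev] at this
      linarith
    have h3 : 1 + ‖b‖ ≤ 2 * (1 + ‖z‖) := by linarith [norm_nonneg z]
    have hz0 : 0 < (1 + ‖z‖) ^ K := by positivity
    have hb0 : 0 < (1 + ‖b‖) ^ K := by positivity
    have h4 : (1 + ‖b‖) ^ K ≤ 2 ^ K * (1 + ‖z‖) ^ K := by
      rw [← Real.mul_rpow (by norm_num) (by positivity)]
      exact Real.rpow_le_rpow (by positivity) h3 hK.le
    rw [Real.rpow_neg (by positivity), ← div_eq_mul_inv, le_div_iff₀ hb0]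
    calc ‖fderiv ℝ η z‖ * (1 + ‖b‖) ^ K
        ≤ ‖fderiv ℝ η z‖ * (2 ^ K * (1 + ‖z‖) ^ K) := by gcongr
      _ = ((1 + ‖z‖) ^ K * ‖fderiv ℝ η z‖) * 2 ^ K := by ring
      _ ≤ c * 2 ^ K := by gcongr; exact hd z
  have := (convex_segment b a).norm_image_sub_le_of_norm_fderiv_le (𝕜 := ℝ)
    (fun z _ => (hη.differentiable one_ne_zero) z) hbd
    (left_mem_segment ℝ b a) (right_mem_segment ℝ b a)
  simpa using this

theorem abs_le_of_gauss_decay {n : ℕ} {η : EuclideanSpace ℝ (Fin n) → ℝ} {K p c : ℝ}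
    (hd : ∀ y, (1 + ‖y‖) ^ K * Real.exp (p ^ 2 * ‖y‖ ^ 2) * |η y| ≤ c)
    (y : EuclideanSpace ℝ (Fin n)) :
    Real.exp (p ^ 2 * ‖y‖ ^ 2) * |η y| ≤ c * (1 + ‖y‖) ^ (-K) := by
  rw [Real.rpow_neg (by positivity), ← div_eq_mul_inv, le_div_iff₀ (by positivity)]
  linarith [hd y]

/-! ### The approximate partition of unity -/

/-- Polynomial multiples of the dilated generating functions form a partition of unity up to `ε`,
with polynomials of bounded degree and with a bound on the multiples that does not depend on `ε`.
The polynomials approximate `1 / ∑ η ((· - x_m) / h_m)` in the coordinates of the node `x_j`. -/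
theorem exists_approximate_partition_of_unity {n : ℕ} {K p cK cp cs ρ : ℝ} (hK : 0 < K)
    (hp : 0 < p) (hcs : 0 < cs) (hρ : 1 ≤ ρ) {ι : Type*} {x : ι → EuclideanSpace ℝ (Fin n)}
    {h : ι → ℝ} {η : EuclideanSpace ℝ (Fin n) → ℝ} (hh : ∀ j, 0 < h j)
    (hcK : gridNorm x h (-K) ≤ ENNReal.ofReal cK) (hη : ContDiff ℝ 1 η)
    (hd : ∀ y, (1 + ‖y‖) ^ K * Real.exp (p ^ 2 * ‖y‖ ^ 2) * |η y| ≤ cp)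
    (hd' : ∀ y, (1 + ‖y‖) ^ K * ‖fderiv ℝ η y‖ ≤ cp) (hq : ∀ j m, h j / h m ≤ ρ)
    (hlow : ∀ y, cs ≤ ∑' j, η ((h j)⁻¹ • (y - x j))) {ε : ℝ} (hε : 0 < ε) :
    ∃ (L : ℕ) (P : ι → MvPolynomial (Fin n) ℝ), (∀ j, (P j).totalDegree ≤ L) ∧
      (∀ j (t : EuclideanSpace ℝ (Fin n)), |MvPolynomial.eval (fun i => t i) (P j) * η t|
        ≤ (cs⁻¹ + 1) * cp * (1 + ‖t‖) ^ (-K)) ∧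
      ∀ y, |∑' j, MvPolynomial.eval (fun i => ((h j)⁻¹ • (y - x j)) i) (P j)
        * η ((h j)⁻¹ • (y - x j)) - 1| ≤ ε := by
  have hcp0 : 0 ≤ cp := le_trans (by positivity) (hd 0)
  set c₁ := max cK 0 with hc₁
  have hc₁0 : 0 ≤ c₁ := le_max_right _ _
  have hS := summable_and_tsum_le_of_gridNorm_le hh hcK
  have hηle : ∀ t, |η t| ≤ cp * (1 + ‖t‖) ^ (-K) := fun t =>
    (le_mul_of_one_le_left (abs_nonneg _) (Real.one_le_exp (by positivity))).trans
      (abs_le_of_gauss_decay hd t)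
  have hηs : ∀ y, Summable fun j => η ((h j)⁻¹ • (y - x j)) := fun y =>
    Summable.of_norm_bounded ((hS y).1.mul_left cp) fun j => hηle _
  set Θ : EuclideanSpace ℝ (Fin n) → ℝ := fun y => ∑' j, η ((h j)⁻¹ • (y - x j)) with hΘ
  have hΘpos : ∀ y, 0 < Θ y := fun y => hcs.trans_le (hlow y)
  -- `Θ` in the coordinates of the node `x_j` is Lipschitz, uniformly in `j`
  have hΘlip : ∀ j (s t : EuclideanSpace ℝ (Fin n)), ‖s - t‖ ≤ ρ⁻¹ →
      |Θ (x j + h j • s) - Θ (x j + h j • t)| ≤ cp * 2 ^ K * ρ * c₁ * ‖s - t‖ := by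
    intro j s t hst
    have hρ0 : 0 < ρ := by linarith
    set T : ι → EuclideanSpace ℝ (Fin n) → EuclideanSpace ℝ (Fin n) :=
      fun m y => (h m)⁻¹ • (y - x m) with hT
    have hdiff : ∀ m, T m (x j + h j • s) - T m (x j + h j • t) = (h j / h m) • (s - t) := by
      intro m
      simp only [hT]
      rw [← smul_sub, sub_sub_sub_cancel_right, add_sub_add_left_eq_sub, ← smul_sub, smul_smul,
        inv_mul_eq_div]
    have hnd : ∀ m, ‖T m (x j + h j • s) - T m (x j + h j • t)‖ ≤ ρ * ‖s - t‖ := fun m => by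
      rw [hdiff, norm_smul, Real.norm_eq_abs, abs_of_pos (div_pos (hh j) (hh m))]
      exact mul_le_mul_of_nonneg_right (hq j m) (norm_nonneg _)
    have hle : ∀ m, |η (T m (x j + h j • s)) - η (T m (x j + h j • t))|
        ≤ cp * 2 ^ K * ρ * ‖s - t‖ * (1 + ‖T m (x j + h j • t)‖) ^ (-K) := fun m => by
      have h1 : ρ * ‖s - t‖ ≤ 1 := by
        calc ρ * ‖s - t‖ ≤ ρ * ρ⁻¹ := by gcongr
          _ = 1 := mul_inv_cancel₀ hρ0.ne'
      refine (abs_sub_le_of_norm_fderiv_decay hK hη hd' ((hnd m).trans h1)).trans ?_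
      calc _ ≤ cp * 2 ^ K * (1 + ‖T m (x j + h j • t)‖) ^ (-K) * (ρ * ‖s - t‖) := by
            gcongr
            exact hnd m
        _ = _ := by ring
    have hsum := (hS (x j + h j • t)).1.mul_left (cp * 2 ^ K * ρ * ‖s - t‖)
    have h2 : Θ (x j + h j • s) - Θ (x j + h j • t)
        = ∑' m, (η (T m (x j + h j • s)) - η (T m (x j + h j • t))) :=
      ((hηs (x j + h j • s)).tsum_sub (hηs (x j + h j • t))).symm
    rw [h2, ← Real.norm_eq_abs]
    refine (tsum_of_norm_bounded hsum.hasSum hle).trans ?_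
    rw [tsum_mul_left]
    calc _ ≤ cp * 2 ^ K * ρ * ‖s - t‖ * c₁ := by
          gcongr
          exact (hS (x j + h j • t)).2
      _ = _ := by ring
  obtain ⟨L, P, hP⟩ := exists_polynomial_family_near
    (fun j (t : EuclideanSpace ℝ (Fin n)) => (Θ (x j + h j • t))⁻¹) (A := cs⁻¹)
    (fun j t => by
      rw [abs_of_pos (inv_pos.mpr (hΘpos _))]
      exact inv_anti₀ hcs (hlow _))
    (fun τ hτ => by
      set B := cp * 2 ^ K * ρ * c₁ with hB
      have hB0 : 0 ≤ B := by positivity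
      refine ⟨min ρ⁻¹ (τ * cs ^ 2 / (B + 1)), lt_min (by positivity) (by positivity),
        fun j s t hst => ?_⟩
      have h1 := hΘlip j s t (hst.le.trans (min_le_left _ _))
      have h2 : ‖s - t‖ * (B + 1) ≤ τ * cs ^ 2 :=
        (le_div_iff₀ (by positivity)).mp (hst.le.trans (min_le_right _ _))
      set a := Θ (x j + h j • s)
      set b := Θ (x j + h j • t)
      have ha : cs ≤ a := hlow _
      have hb : cs ≤ b := hlow _
      have ha0 : 0 < a := hcs.trans_le ha
      have hb0 : 0 < b := hcs.trans_le hb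
      rw [inv_sub_inv ha0.ne' hb0.ne', abs_div, abs_of_pos (mul_pos ha0 hb0),
        div_le_iff₀ (mul_pos ha0 hb0), abs_sub_comm]
      have h3 : cs ^ 2 ≤ a * b := by rw [sq]; gcongr
      calc |a - b| ≤ B * ‖s - t‖ := h1
        _ ≤ τ * cs ^ 2 := by nlinarith [norm_nonneg (s - t)]
        _ ≤ τ * (a * b) := by gcongr)
    (c := p ^ 2) (δ := min 1 (ε / (cp * c₁ + 1))) (by positivity)
    (lt_min one_pos (by positivity))
  refine ⟨L, P, fun j => (hP j).1, fun j t => ?_, fun y => ?_⟩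
  · have h1 := (hP j).2 t
    set E := Real.exp (p ^ 2 * ‖t‖ ^ 2)
    have hE1 : 1 ≤ E := Real.one_le_exp (by positivity)
    have h2 : |MvPolynomial.eval (fun i => t i) (P j)| ≤ (cs⁻¹ + 1) * E := by
      have h3 : |(Θ (x j + h j • t))⁻¹| ≤ cs⁻¹ * E := by
        rw [abs_of_pos (inv_pos.mpr (hΘpos _))]
        exact (inv_anti₀ hcs (hlow _)).trans (le_mul_of_one_le_right (by positivity) hE1)
      have h4 : min 1 (ε / (cp * c₁ + 1)) * E ≤ 1 * E := by
        gcongr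
        exact min_le_left _ _
      have h5 := abs_sub_abs_le_abs_sub (MvPolynomial.eval (fun i => t i) (P j))
        (Θ (x j + h j • t))⁻¹
      linarith
    rw [abs_mul]
    calc _ ≤ (cs⁻¹ + 1) * E * |η t| := by gcongr
      _ = (cs⁻¹ + 1) * (E * |η t|) := by ring
      _ ≤ (cs⁻¹ + 1) * (cp * (1 + ‖t‖) ^ (-K)) :=
          mul_le_mul_of_nonneg_left (abs_le_of_gauss_decay hd t) (by positivity)
      _ = _ := by ring
  · set T : ι → EuclideanSpace ℝ (Fin n) := fun j => (h j)⁻¹ • (y - x j) with hT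
    have hback : ∀ j, x j + h j • T j = y := fun j => by
      simp only [hT]
      rw [smul_inv_smul₀ (hh j).ne', add_sub_cancel]
    set δ := min 1 (ε / (cp * c₁ + 1)) with hδ
    have hδ0 : 0 ≤ δ := le_min zero_le_one (by positivity)
    have hterm : ∀ j, ‖(MvPolynomial.eval (fun i => T j i) (P j) - (Θ y)⁻¹) * η (T j)‖
        ≤ δ * cp * (1 + ‖T j‖) ^ (-K) := fun j => by
      have h1 := (hP j).2 (T j)
      rw [hback] at h1
      rw [norm_mul, Real.norm_eq_abs, Real.norm_eq_abs]
      calc _ ≤ δ * Real.exp (p ^ 2 * ‖T j‖ ^ 2) * |η (T j)| := by gcongr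
        _ = δ * (Real.exp (p ^ 2 * ‖T j‖ ^ 2) * |η (T j)|) := by ring
        _ ≤ δ * (cp * (1 + ‖T j‖) ^ (-K)) :=
            mul_le_mul_of_nonneg_left (abs_le_of_gauss_decay hd _) hδ0
        _ = _ := by ring
    have hbs := (hS y).1.mul_left (δ * cp)
    have hs1 : Summable fun j => (MvPolynomial.eval (fun i => T j i) (P j) - (Θ y)⁻¹) * η (T j) :=
      Summable.of_norm_bounded hbs hterm
    have hs2 : Summable fun j => (Θ y)⁻¹ * η (T j) := (hηs y).mul_left _
    have heq : ∑' j, MvPolynomial.eval (fun i => T j i) (P j) * η (T j) - 1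
        = ∑' j, (MvPolynomial.eval (fun i => T j i) (P j) - (Θ y)⁻¹) * η (T j) := by
      have h1 : ∑' j, (Θ y)⁻¹ * η (T j) = 1 := by
        rw [tsum_mul_left]; exact inv_mul_cancel₀ (hΘpos y).ne'
      rw [← h1, sub_eq_iff_eq_add, ← hs1.tsum_add hs2]
      exact tsum_congr fun j => by ring
    rw [heq, ← Real.norm_eq_abs]
    refine (tsum_of_norm_bounded hbs.hasSum hterm).trans ?_
    rw [tsum_mul_left]
    calc δ * cp * ∑' j, (1 + ‖T j‖) ^ (-K) ≤ δ * cp * c₁ := by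
          gcongr
          exact (hS y).2
      _ ≤ ε / (cp * c₁ + 1) * (cp * c₁ + 1) := by
          rw [mul_assoc]
          gcongr
          · exact min_le_right _ _
          · linarith
      _ = ε := div_mul_cancel₀ _ (by positivity)

/-! ### The quasi-interpolant -/

theorem MemSobolevInfty.exists_bound {n N : ℕ} {u : EuclideanSpace ℝ (Fin n) → ℝ}
    (huc : Continuous u) (hu : MemSobolevInfty N u) : ∃ B, ∀ y, |u y| ≤ B := by
  refine ⟨(eLpNorm u ⊤ volume).toReal, fun y => ?_⟩
  have hae : ∀ᵐ y, |u y| ≤ (eLpNorm u ⊤ volume).toReal := by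
    have hle : ∀ᵐ y, ‖u y‖ₑ ≤ eLpNorm u ⊤ volume := by
      rw [eLpNorm_exponent_top]
      exact ae_le_eLpNormEssSup
    filter_upwards [hle] with z hz
    simpa using ENNReal.toReal_mono hu.1.2.ne hz
  exact forall_of_ae_of_isClosed (isClosed_le huc.abs continuous_const) hae y

/-- If the terms that belong to the star of `x_j` have absolute sum at most `b j`, with `b`
summable, then the quasi-interpolant converges absolutely and may be summed star by star. -/
theorem quasiInterpolant_eq_tsum_stars {n : ℕ} {ι : Type*} [DecidableEq ι]
    {x : ι → EuclideanSpace ℝ (Fin n)} {h : ι → ℝ} {st : ι → Finset ι}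
    {η : EuclideanSpace ℝ (Fin n) → ℝ} {P : ι → ι → MvPolynomial (Fin n) ℝ}
    (hP0 : ∀ j k, k ∉ insert j (st j) → P j k = 0) {y : EuclideanSpace ℝ (Fin n)} {b : ι → ℝ}
    (hb : Summable b) (hPb : ∀ j, ∑ k ∈ insert j (st j), |basisTerm x h η P j k y| ≤ b j)
    {u : EuclideanSpace ℝ (Fin n) → ℝ} {B : ℝ} (hB : ∀ y, |u y| ≤ B) :
    (∀ k, Summable fun j : {j : ι // k ∈ fullStar st j} => basisTerm x h η P j k y) ∧
      (Summable fun k => u (x k) * nodeCoeff x h st η P k y) ∧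
      quasiInterpolant x h st η P u y
        = ∑' j, ∑ k ∈ insert j (st j), u (x k) * basisTerm x h η P j k y := by
  have hB0 : 0 ≤ B := (abs_nonneg _).trans (hB y)
  set a : ι → ι → ℝ := fun j k => basisTerm x h η P j k y with ha
  have ha0 : ∀ j k, k ∉ insert j (st j) → a j k = 0 := fun j k hk => by
    simp only [ha, basisTerm, hP0 j k hk, map_zero, zero_mul]
  have hle : ∀ j k, |a j k| ≤ b j := fun j k => by
    by_cases hk : k ∈ insert j (st j)
    · exact (Finset.single_le_sum (f := fun k => |a j k|) (fun _ _ => abs_nonneg _) hk).trans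
        (hPb j)
    · rw [ha0 j k hk, abs_zero]
      exact (Finset.sum_nonneg fun _ _ => abs_nonneg _).trans (hPb j)
  have hcol : ∀ k, Summable fun j => a j k := fun k => Summable.of_norm_bounded hb fun j => hle j k
  have hnode : ∀ k, nodeCoeff x h st η P k y = ∑' j, a j k := fun k => by
    have h1 : Function.support (fun j => a j k) ⊆ {j | k ∈ fullStar st j} := fun j hj => by
      by_contra hk
      refine hj (ha0 j k fun hmem => hk ?_)
      simpa [fullStar] using hmem
    exact tsum_subtype_eq_of_support_subset h1
  have hprod : Summable fun q : ι × ι => u (x q.2) * a q.1 q.2 := by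
    refine Summable.of_norm ((summable_prod_of_nonneg fun _ => norm_nonneg _).mpr
      ⟨fun j => ?_, ?_⟩)
    · exact summable_of_ne_finset_zero (s := insert j (st j)) fun k hk => by
        simp only [ha0 j k hk, mul_zero, norm_zero]
    · refine Summable.of_nonneg_of_le (fun j => tsum_nonneg fun _ => norm_nonneg _)
        (fun j => ?_) (hb.mul_left B)
      rw [tsum_eq_sum (s := insert j (st j)) fun k hk => by
        simp only [ha0 j k hk, mul_zero, norm_zero]]
      calc ∑ k ∈ insert j (st j), ‖u (x k) * a j k‖
          ≤ ∑ k ∈ insert j (st j), B * |a j k| := by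
            refine Finset.sum_le_sum fun k _ => ?_
            rw [norm_mul, Real.norm_eq_abs, Real.norm_eq_abs]
            exact mul_le_mul_of_nonneg_right (hB _) (abs_nonneg _)
        _ ≤ B * b j := by
            rw [← Finset.mul_sum]
            exact mul_le_mul_of_nonneg_left (hPb j) hB0
  have houter : ∀ k, u (x k) * nodeCoeff x h st η P k y = ∑' j, u (x k) * a j k := fun k => by
    rw [hnode, tsum_mul_left]
  refine ⟨fun k => (hcol k).subtype _, ?_, ?_⟩
  · simp_rw [houter]
    exact hprod.prod_symm.prod
  · have hswap : ∑' k, ∑' j, u (x k) * a j k = ∑' j, ∑' k, u (x k) * a j k :=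
      Summable.tsum_comm hprod
    rw [quasiInterpolant]
    simp_rw [houter]
    rw [hswap]
    exact tsum_congr fun j => tsum_eq_sum fun k hk => by rw [ha0 j k hk, mul_zero]

theorem mainTheorem5 (n N : ℕ) (hN : 1 ≤ N) (K p : ℝ) (hK : 0 < K) (hp : 0 < p)
    (cK cNK cp cs cV ρ : ℝ) (hcs : 0 < cs) (hcV : 0 < cV) (hρ : 1 ≤ ρ) :
    ∃ C : ℝ, ∀ (ι : Type*) (x : ι → EuclideanSpace ℝ (Fin n)) (h : ι → ℝ) (st : ι → Finset ι)
      (η : EuclideanSpace ℝ (Fin n) → ℝ),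
      (∀ j, 0 < h j) →
      StarCondition N cV x h st →
      gridNorm x h (-K) ≤ ENNReal.ofReal cK →
      gridNorm x h (N - K) ≤ ENNReal.ofReal cNK →
      ContDiff ℝ 1 η →
      (∀ y, (1 + ‖y‖) ^ K * Real.exp (p ^ 2 * ‖y‖ ^ 2) * |η y| ≤ cp) →
      (∀ y, (1 + ‖y‖) ^ K * ‖fderiv ℝ η y‖ ≤ cp) →
      (∀ j m, h j / h m ≤ ρ) →
      (∀ y, cs ≤ ∑' j, η ((h j)⁻¹ • (y - x j))) →
      ∀ ε : ℝ, 0 < ε →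
        ∃ P : ι → ι → MvPolynomial (Fin n) ℝ,
          (∃ L : ℕ, ∀ j k, (P j k).totalDegree ≤ L) ∧
          ∀ u : EuclideanSpace ℝ (Fin n) → ℝ, Continuous u → MemSobolevInfty N u →
            ∀ y : EuclideanSpace ℝ (Fin n),
              (∀ k, Summable fun j : {j : ι // k ∈ fullStar st j} => basisTerm x h η P j k y) ∧
              (Summable fun k => u (x k) * nodeCoeff x h st η P k y) ∧
              |quasiInterpolant x h st η P u y - u y| ≤
                C * (⨆ m, h m ^ N) * gradNorm N u + ε * |u y| := by
  obtain ⟨D, hD⟩ : ∃ D : ℝ, D = ((n : ℝ) ^ N + 1) * (1 + 2 *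
      ((Fintype.card (multiIdx n N) : ℝ) ^ 2 *
        ((Fintype.card (multiIdx n N)).factorial / cV))) := ⟨_, rfl⟩
  have hD0 : 0 ≤ D := by rw [hD]; positivity
  refine ⟨(cs⁻¹ + 1) * cp * D * max cNK 0, ?_⟩
  intro ι x h st η hh hst hgK hgNK hη hd hd' hq hlow ε hε
  classical
  have hcp0 : 0 ≤ cp := le_trans (by positivity) (hd 0)
  set A := (cs⁻¹ + 1) * cp with hA
  have hA0 : 0 ≤ A := by positivity
  obtain ⟨L, Q, hQdeg, hQle, hQone⟩ := exists_approximate_partition_of_unity hK hp hcs hρ hh hgK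
    hη hd hd' hq hlow hε
  -- the constant `D` of the interpolation depends on `n`, `N` and `cV` only, so that `C` is uniform
  choose Λ hΛ0 hΛdeg hΛle hΛerr using exists_star_interpolation hN hcV hh hst hD
  refine ⟨fun j k => Q j * Λ j k, ⟨L + N, fun j k =>
    (MvPolynomial.totalDegree_mul _ _).trans (add_le_add (hQdeg j) (hΛdeg j k))⟩, ?_⟩
  intro u huc hu y
  obtain ⟨B, hB⟩ := hu.exists_bound huc
  obtain ⟨hs1, hb1⟩ := summable_and_tsum_le_of_gridNorm_le hh hgNK y
  have hs0 := (summable_and_tsum_le_of_gridNorm_le hh hgK y).1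
  set T : ι → EuclideanSpace ℝ (Fin n) := fun j => (h j)⁻¹ • (y - x j) with hT
  have hback : ∀ j, x j + h j • T j = y := fun j => by
    simp only [hT]
    rw [smul_inv_smul₀ (hh j).ne', add_sub_cancel]
  have hpow : ∀ j, (1 + ‖T j‖) ^ (-K) * (1 + ‖T j‖) ^ N = (1 + ‖T j‖) ^ ((N : ℝ) - K) := fun j => by
    rw [← Real.rpow_natCast, ← Real.rpow_add (by positivity)]
    congr 1
    ring
  set q : ι → ℝ := fun j => MvPolynomial.eval (fun i => T j i) (Q j) * η (T j) with hqdef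
  have hqle : ∀ j, |q j| ≤ A * (1 + ‖T j‖) ^ (-K) := fun j => hQle j (T j)
  have hterm : ∀ j k, basisTerm x h η (fun j k => Q j * Λ j k) j k y
      = q j * MvPolynomial.eval (fun i => T j i) (Λ j k) := fun j k => by
    simp only [basisTerm, map_mul, hqdef, hT]
    ring
  obtain ⟨hsum1, hsum2, hMu⟩ := quasiInterpolant_eq_tsum_stars (x := x) (h := h) (η := η)
    (P := fun j k => Q j * Λ j k) (st := st) (y := y)
    (b := fun j => A * D * (1 + ‖T j‖) ^ ((N : ℝ) - K))
    (fun j k hk => by rw [hΛ0 j k hk, mul_zero]) (hs1.mul_left (A * D))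
    (fun j => by
      simp_rw [hterm, abs_mul]
      rw [← Finset.mul_sum]
      calc _ ≤ (A * (1 + ‖T j‖) ^ (-K)) * (D * (1 + ‖T j‖) ^ N) :=
            mul_le_mul (hqle j) (hΛle j (T j)) (Finset.sum_nonneg fun _ _ => abs_nonneg _)
              (by positivity)
        _ = A * D * ((1 + ‖T j‖) ^ (-K) * (1 + ‖T j‖) ^ N) := by ring
        _ = _ := by rw [hpow])
    hB
  refine ⟨hsum1, hsum2, ?_⟩
  set H := ⨆ m, h m ^ N with hH
  have hHle : ∀ j, h j ^ N ≤ H := fun j => by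
    refine le_ciSup (f := fun m => h m ^ N) ⟨(ρ * h j) ^ N, ?_⟩ j
    rintro _ ⟨m, rfl⟩
    exact pow_le_pow_left₀ (hh m).le ((div_le_iff₀ (hh j)).mp (hq m j)) N
  set G := gradNorm N u with hG
  have hG0 : 0 ≤ G := ENNReal.toReal_nonneg
  set I : ι → ℝ := fun j => ∑ k ∈ insert j (st j),
    MvPolynomial.eval (fun i => T j i) (Λ j k) * u (x k) with hI
  have hIerr : ∀ j, |I j - u y| ≤ D * G * h j ^ N * (1 + ‖T j‖) ^ N := fun j => by
    have := hΛerr j u huc hu (T j)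
    rwa [hback] at this
  have hstar : ∀ j, ∑ k ∈ insert j (st j), u (x k) * basisTerm x h η (fun j k => Q j * Λ j k) j k y
      = q j * I j := fun j => by
    rw [hI, Finset.mul_sum]
    exact Finset.sum_congr rfl fun k _ => by rw [hterm]; ring
  have hb2 : ∀ j, ‖q j * (I j - u y)‖ ≤ A * D * G * H * (1 + ‖T j‖) ^ ((N : ℝ) - K) := fun j => by
    rw [norm_mul, Real.norm_eq_abs, Real.norm_eq_abs]
    have hj0 := (hh j).le
    calc _ ≤ (A * (1 + ‖T j‖) ^ (-K)) * (D * G * h j ^ N * (1 + ‖T j‖) ^ N) :=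
          mul_le_mul (hqle j) (hIerr j) (abs_nonneg _) (by positivity)
      _ = A * D * G * h j ^ N * ((1 + ‖T j‖) ^ (-K) * (1 + ‖T j‖) ^ N) := by ring
      _ = A * D * G * h j ^ N * (1 + ‖T j‖) ^ ((N : ℝ) - K) := by rw [hpow]
      _ ≤ _ := by
          gcongr
          exact hHle j
  have hbs := hs1.mul_left (A * D * G * H)
  have hqs : Summable q := Summable.of_norm_bounded (hs0.mul_left A) hqle
  have hsd : Summable fun j => q j * (I j - u y) := Summable.of_norm_bounded hbs hb2
  have hsplit : quasiInterpolant x h st η (fun j k => Q j * Λ j k) u y - u y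
      = ∑' j, q j * (I j - u y) + (∑' j, q j - 1) * u y := by
    have h1 : ∑' j, q j * I j = ∑' j, q j * (I j - u y) + (∑' j, q j) * u y := by
      rw [← tsum_mul_right, ← hsd.tsum_add (hqs.mul_right _)]
      exact tsum_congr fun j => by ring
    rw [hMu, tsum_congr hstar, h1]
    ring
  rw [hsplit]
  have hH0 : 0 ≤ H := Real.iSup_nonneg fun m => pow_nonneg (hh m).le N
  have hfirst : |∑' j, q j * (I j - u y)| ≤ A * D * max cNK 0 * H * G := by
    rw [← Real.norm_eq_abs]
    refine (tsum_of_norm_bounded hbs.hasSum hb2).trans ?_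
    rw [tsum_mul_left]
    calc _ ≤ A * D * G * H * max cNK 0 := by gcongr
      _ = _ := by ring
  have hsecond : |(∑' j, q j - 1) * u y| ≤ ε * |u y| := by
    rw [abs_mul]
    exact mul_le_mul_of_nonneg_right (hQone y) (abs_nonneg _)
  exact (abs_add_le _ _).trans (add_le_add hfirst hsecond)
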